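/- Let $N\ge 1$ and let $x_0,\dots,x_N$ be a zero-mean nonsingular Gaussian sequence of random vectors in $\mathbb{R}^d$ on a probability space, i.e. $(x_0,\dots,x_N)$ is jointly Gaussian with mean zero and the covariance matrix of the whole sequence is nonsingular. The sequence is called *reciprocal* if for all $0\le k_1<k_2\le N$ the families $(x_k)_{k_1<k<k_2}$ and $(x_k)_{k\notin[k_1,k_2]}$ are conditionally independent given $(x_{k_1},x_{k_2})$, and *Markov* if for every $k$ the families $(x_i)_{i<k}$ and $(x_i)_{i>k}$ are conditionally independent given $x_k$. Let $c\in\{0,N\}$. The sequence is said to be governed by the backward $CM_c$ model with $d\times d$ parameter matrices $G^B_{k,l}$ and $G^B_k$ if there is a zero-mean white Gaussian sequence $e^B_0,\dots,e^B_N$ (jointly Gaussian with $\mathrm{Cov}(e^B_k,e^B_l)=0$ for $k\ne l$) with nonsingular covariances $\mathrm{Cov}(e^B_k)=G^B_k$ such that almost surely $$x_k=G^B_{k,k+1}x_{k+1}+G^B_{k,c}x_c+e^B_k,\qquad k\in\{0,\dots,N-1\}\setminus\{c\},$$ (for $c=N$ and $k=N-1$ both coefficients are the same matrix $G^B_{N-1,N}$),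 along with one of the following boundary conditions, which coincide for $c=N$: * (BC1) $x_N=e^B_N$, and, if $c=0$, also $x_0=G^B_{0,N}x_N+e^B_0$; * (BC2) $x_c=e^B_c$, and, if $c=0$, also $x_N=G^B_{N,0}x_0+e^B_N$. Fix $c\in\{0,N\}$ and one of the two forms of the boundary condition. Consider the condition $$(G^B_{k+1})^{-1}G^B_{k+1,c}=(G^B_{k,k+1})'(G^B_k)^{-1}G^B_{k,c}\qquad(\mathrm R)$$ for all integers $0<k<N-1$ if $c=0$, and for all integers $0\le k<N-2$ if $c=N$. Consider also the condition (M), given by * for $c=0$ and (BC1): $(G^B_0)^{-1}G^B_{0,N}=(G^B_{N-1,0})'(G^B_{N-1})^{-1}G^B_{N-1,N}$; * for $c=0$ and (BC2): $(G^B_N)^{-1}G^B_{N,0}=(G^B_{N-1,N})'(G^B_{N-1})^{-1}G^B_{N-1,0}$; * for $c=N$: $G^B_{0,N}=0$. Then: 1. $[x_k]$ is reciprocal if and only if it is governed by a backward $CM_c$ model with the chosen boundary condition whose parameters satisfy (R). 2. If $N\ge 2$, then $[x_k]$ is Markov if and only if it is governed by such a model whose parameters satisfy (R) and (M). 3. Whenever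 $[x_k]$ is governed by a backward $CM_c$ model with the chosen boundary condition, $[x_k]$ is reciprocal if and only if the parameters of this model satisfy (R), and, if $N\ge2$, it is Markov if and only if they satisfy (R) and (M). -/

import Mathlib

open MeasureTheory ProbabilityTheory Matrix

noncomputable section

namespace CMSequence

variable {Ω : Type*} [MeasurableSpace Ω] {N d : ℕ}

/-- Conditional independence of two sigma-algebras `m₁`, `m₂` given a sigma-algebra `m`:
`P(A ∩ B | m) = P(A | m) P(B | m)` almost surely for all `A ∈ m₁`, `B ∈ m₂`. -/
def CondIndepGiven (P : Measure Ω) (m m₁ m₂ : MeasurableSpace Ω) : Prop :=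
  ∀ A B : Set Ω, MeasurableSet[m₁] A → MeasurableSet[m₂] B →
    P⟦A ∩ B | m⟧ =ᵐ[P] P⟦A | m⟧ * P⟦B | m⟧

/-- The sigma-algebra generated by the states `x k`, `k ∈ S`, of a sequence
`x 0, …, x N` of random vectors in `ℝ^d`. -/
abbrev sigmaOf (x : Fin (N + 1) → Ω → (Fin d → ℝ)) (S : Set (Fin (N + 1))) : MeasurableSpace Ω :=
  ⨆ k ∈ S, MeasurableSpace.comap (x k) inferInstance

/-- A sequence is Markov if, conditioned on the state at any time `k`, the subsequences
before and after `k` are independent. -/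
def IsMarkov (P : Measure Ω) (x : Fin (N + 1) → Ω → (Fin d → ℝ)) : Prop :=
  ∀ k : Fin (N + 1),
    CondIndepGiven P (sigmaOf x {k}) (sigmaOf x (Set.Iio k)) (sigmaOf x (Set.Ioi k))

/-- A sequence is reciprocal if, conditioned on the states at any two times `k₁ < k₂`, the
subsequences inside and outside the interval `[k₁, k₂]` are independent. -/
def IsReciprocal (P : Measure Ω) (x : Fin (N + 1) → Ω → (Fin d → ℝ)) : Prop :=
  ∀ k₁ k₂ : Fin (N + 1), k₁ < k₂ →
    CondIndepGiven P (sigmaOf x {k₁, k₂}) (sigmaOf x (Set.Ioo k₁ k₂))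
      (sigmaOf x (Set.Icc k₁ k₂)ᶜ)

/-- The cross-covariance matrix of two random vectors. -/
def crossCov (P : Measure Ω) (X Y : Ω → (Fin d → ℝ)) : Matrix (Fin d) (Fin d) ℝ :=
  Matrix.of fun i j => cov[fun ω => X ω i, fun ω => Y ω j; P]

/-- The covariance matrix of the whole sequence; its block `(k, l)` is the
cross-covariance of `x k` and `x l`. -/
def seqCov (P : Measure Ω) (x : Fin (N + 1) → Ω → (Fin d → ℝ)) :
    Matrix (Fin (N + 1) × Fin d) (Fin (N + 1) × Fin d) ℝ :=
  Matrix.of fun a b => crossCov P (x a.1) (x b.1) a.2 b.2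

/-- Zero-mean nonsingular Gaussian sequence: jointly Gaussian, centred, and the covariance
matrix of the whole sequence is nonsingular. -/
structure IsZMNG (P : Measure Ω) (x : Fin (N + 1) → Ω → (Fin d → ℝ)) : Prop where
  gaussian : IsGaussianProcess x P
  zero_mean : ∀ k, ∫ ω, x k ω ∂P = 0
  nonsingular : (seqCov P x).det ≠ 0

/-- Zero-mean white Gaussian sequence with nonsingular covariances `V k`. -/
structure IsWhiteGaussian (P : Measure Ω) (e : Fin (N + 1) → Ω → (Fin d → ℝ))
    (V : Fin (N + 1) → Matrix (Fin d) (Fin d) ℝ) : Prop where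
  gaussian : IsGaussianProcess e P
  zero_mean : ∀ k, ∫ ω, e k ω ∂P = 0
  white : ∀ k l, k ≠ l → crossCov P (e k) (e l) = 0
  cov_eq : ∀ k, crossCov P (e k) (e k) = V k
  nonsingular : ∀ k, (V k).det ≠ 0

/-- The parameters of a backward model: the coefficient matrices `G k l` (written
`G^B_{k,l}`) and the noise covariance matrices `V k` (written `G^B_k`). -/
structure BackwardParams (N d : ℕ) where
  G : Fin (N + 1) → Fin (N + 1) → Matrix (Fin d) (Fin d) ℝ
  V : Fin (N + 1) → Matrix (Fin d) (Fin d) ℝ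

/-- The two alternative forms of the boundary condition. -/
inductive BoundaryForm
  | first
  | second

/-- The boundary condition. First form: `x_N = e_N`, and, if `c = 0`, also
`x_c = G_{c,N} x_N + e_c`. Second form: `x_c = e_c`, and, if `c = 0`, also
`x_N = G_{N,c} x_c + e_N`. For `c = N` both forms say `x_N = e_N`. -/
def BoundaryCondition (P : Measure Ω) (x e : Fin (N + 1) → Ω → (Fin d → ℝ))
    (c : Fin (N + 1)) (M : BackwardParams N d) : BoundaryForm → Prop
  | .first =>
      (∀ᵐ ω ∂P, x (Fin.last N) ω = e (Fin.last N) ω) ∧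
      (c = 0 → ∀ᵐ ω ∂P, x c ω = M.G c (Fin.last N) *ᵥ x (Fin.last N) ω + e c ω)
  | .second =>
      (∀ᵐ ω ∂P, x c ω = e c ω) ∧
      (c = 0 → ∀ᵐ ω ∂P, x (Fin.last N) ω = M.G (Fin.last N) c *ᵥ x c ω + e (Fin.last N) ω)

/-- The sequence `x` is governed by the backward `CM_c` model with parameters `M` and
boundary condition of form `b`:
`x_k = G_{k,k+1} x_{k+1} + G_{k,c} x_c + e_k` for `k ∈ [0, N) \ {c}`, where `e` is a
zero-mean white Gaussian sequence with nonsingular covariances `V k`.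
The index `k : Fin N` runs over `[0, N)`; `k.castSucc` is `k` and `k.succ` is `k + 1`. -/
def GovernedBy (P : Measure Ω) (x : Fin (N + 1) → Ω → (Fin d → ℝ)) (c : Fin (N + 1))
    (b : BoundaryForm) (M : BackwardParams N d) : Prop :=
  ∃ e : Fin (N + 1) → Ω → (Fin d → ℝ),
    IsWhiteGaussian P e M.V ∧
    (∀ k : Fin N, k.castSucc ≠ c → ∀ᵐ ω ∂P,
      x k.castSucc ω =
        M.G k.castSucc k.succ *ᵥ x k.succ ω + M.G k.castSucc c *ᵥ x c ω + e k.castSucc ω) ∧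
    BoundaryCondition P x e c M b

/-- `(G_{k+1})⁻¹ G_{k+1,c} = (G_{k,k+1})' (G_k)⁻¹ G_{k,c}` for all `k ∈ (0, N-1)` if `c = 0`,
and for all `k ∈ [0, N-2)` if `c = N`. -/
def ReciprocalCondition (c : Fin (N + 1)) (M : BackwardParams N d) : Prop :=
  ∀ k : Fin N,
    ((c = 0 ∧ 0 < (k : ℕ) ∧ (k : ℕ) + 1 < N) ∨ (c = Fin.last N ∧ (k : ℕ) + 2 < N)) →
    (M.V k.succ)⁻¹ * M.G k.succ c =
      (M.G k.castSucc k.succ)ᵀ * (M.V k.castSucc)⁻¹ * M.G k.castSucc c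

/-- The time `N - 1`. -/
def penult (N : ℕ) : Fin (N + 1) := ⟨N - 1, by omega⟩

/-- The additional condition for a Markov sequence. If `c = 0`:
`(G_0)⁻¹ G_{0,N} = (G_{N-1,0})' (G_{N-1})⁻¹ G_{N-1,N}` for the first form of the boundary
condition, `(G_N)⁻¹ G_{N,0} = (G_{N-1,N})' (G_{N-1})⁻¹ G_{N-1,0}` for the second form.
If `c = N`: `G_{0,N} = 0`. -/
def MarkovCondition (c : Fin (N + 1)) (b : BoundaryForm) (M : BackwardParams N d) : Prop :=
  (c = 0 →
    match b with
    | .first =>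
        (M.V 0)⁻¹ * M.G 0 (Fin.last N) =
          (M.G (penult N) 0)ᵀ * (M.V (penult N))⁻¹ * M.G (penult N) (Fin.last N)
    | .second =>
        (M.V (Fin.last N))⁻¹ * M.G (Fin.last N) 0 =
          (M.G (penult N) (Fin.last N))ᵀ * (M.V (penult N))⁻¹ * M.G (penult N) 0) ∧
  (c = Fin.last N → M.G 0 (Fin.last N) = 0)

end CMSequence

end

/-! ### Partial linear systems, and conditional independence of sigma-algebras. -/

namespace CMSequence

/-! Everything is read off the block precision matrix `A`, the inverse of the covariance `C` of the
whole sequence. For a centred nonsingular Gaussian family split into groups `S`, `T`, `U`, the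
groups `S` and `T` are conditionally independent given `U` iff the block of `A` between `S` and `T`
vanishes (`condIndepGiven_iff_precision_eq_zero`). Hence Markov means that `A` is block tridiagonal,
and reciprocal means block tridiagonal up to the corner blocks `(0, N)` and `(N, 0)`. For `N ≥ 2`
the two notions differ exactly by the vanishing of the corner.

A backward model says `e = L x` with `L` a sparse matrix with identity diagonal, so it amounts to `L
C Lᴴ = diag V` with every `V k` invertible (`governedBy_iff_covariance`), whence `A = Lᴴ V⁻¹ L`.
Each block of this product off the diagonal involves very few rows of `L`. Blocks at distance at
least two that avoid row and column `c` vanish by sparsity. Blocks `(k+1, c)` are the difference of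
the two sides of (R), and the corner gives (M). This settles every sequence already governed by a
model.

It remains to produce a model for a reciprocal sequence. Block Gaussian elimination of the times, in
an order adapted to `c` and to the boundary form, always gives `L C Lᴴ = diag V` with `L`
unitriangular (`exists_triangular_factorization`). When `A` is cyclically tridiagonal this
elimination creates no fill-in outside the pattern of the model (`factor_ne_zero`), so the
coefficients can be read off `L`. -/

theorem exists_vecMul_eq_on {I : Type*} [Fintype I] [DecidableEq I] {A : Matrix I I ℝ}
    (hA : A.PosDef) (S : Set I) (v : I → ℝ) :
    ∃ w : I → ℝ, (∀ i ∉ S, w i = 0) ∧ ∀ i ∈ S, (w ᵥ* A) i = v i := by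
  classical
  set B := A.submatrix (Subtype.val : S → I) Subtype.val with hB
  -- A principal submatrix of a positive definite matrix is invertible; the solution of the
  -- restricted system is extended by zero.
  have hS : B.PosDef := hA.submatrix Subtype.val_injective
  have hu : IsUnit B.det := hS.det_pos.ne'.isUnit
  set w' : S → ℝ := (fun i : S => v i) ᵥ* B⁻¹ with hw'
  refine ⟨fun i => if h : i ∈ S then w' ⟨i, h⟩ else 0, fun i hi => by simp [hi], fun i hi => ?_⟩
  have h1 : w' ᵥ* B = fun i : S => v i := by
    rw [hw', vecMul_vecMul, nonsing_inv_mul _ hu, vecMul_one]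
  have h2 := congrFun h1 ⟨i, hi⟩
  simp only at h2
  rw [← h2]
  simp only [vecMul, dotProduct]
  symm
  refine Finset.sum_of_injOn Subtype.val Subtype.val_injective.injOn (by simp) ?_ ?_
  · intro j _ hj
    have : j ∉ S := by simpa using hj
    simp [this]
  · intro j _
    simp [hB]

section Freezing

variable {Ω E F G : Type*} {m m₁ m₂ : MeasurableSpace Ω} [mΩ : MeasurableSpace Ω] [MeasurableSpace E] [MeasurableSpace F]
  [mG : MeasurableSpace G]

/-- For `Z` independent of `V`, integrating out `Z` while `V` is frozen. -/
theorem measureReal_inter_preimage_of_indepFun (P : Measure Ω) [IsProbabilityMeasure P]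
    {Z : Ω → E} {V : Ω → F} {U : F → G} (hZ : Measurable Z) (hV : Measurable V)
    (hU : Measurable U) (hZV : Z ⟂ᵢ[P] V) {A : Set (E × G)} (hA : MeasurableSet A)
    {B : Set F} (hB : MeasurableSet B) :
    P.real ((fun ω => (Z ω, U (V ω))) ⁻¹' A ∩ V ⁻¹' B) =
      ∫ ω in V ⁻¹' B, (P.map Z).real ((fun z => (z, U (V ω))) ⁻¹' A) ∂P := by
  have hmap := hZV.map_prod_eq_prod_map_map hZ.aemeasurable hV.aemeasurable
  have : IsProbabilityMeasure (P.map Z) := Measure.isProbabilityMeasure_map hZ.aemeasurable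
  have : IsProbabilityMeasure (P.map V) := Measure.isProbabilityMeasure_map hV.aemeasurable
  set T : Set (E × F) := (fun p => (p.1, U p.2)) ⁻¹' A ∩ Prod.snd ⁻¹' B with hT
  have hTm : MeasurableSet T :=
    (hA.preimage (measurable_fst.prodMk (hU.comp measurable_snd))).inter (measurable_snd hB)
  have hAU : MeasurableSet ((fun p : E × F => (p.1, U p.2)) ⁻¹' A) :=
    hA.preimage (measurable_fst.prodMk (hU.comp measurable_snd))
  have hmeas : Measurable fun v => (P.map Z) ((fun z => (z, U v)) ⁻¹' A) :=
    measurable_measure_prodMk_right hAU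
  have h1 : P ((fun ω => (Z ω, U (V ω))) ⁻¹' A ∩ V ⁻¹' B) =
      ∫⁻ ω in V ⁻¹' B, (P.map Z) ((fun z => (z, U (V ω))) ⁻¹' A) ∂P := by
    have e1 : (fun ω => (Z ω, U (V ω))) ⁻¹' A ∩ V ⁻¹' B = (fun ω => (Z ω, V ω)) ⁻¹' T := rfl
    rw [e1, ← Measure.map_apply (hZ.prodMk hV) hTm, hmap, Measure.prod_apply_symm hTm,
      ← lintegral_indicator (hV hB), lintegral_map (measurable_measure_prodMk_right hTm) hV]
    refine lintegral_congr fun ω => ?_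
    by_cases h : V ω ∈ B
    · rw [Set.indicator_of_mem (by exact h)]
      congr 1
      ext z
      simp [hT, h]
    · rw [Set.indicator_of_notMem (by exact h)]
      have : (fun x => (x, V ω)) ⁻¹' T = ∅ := by
        ext z
        simp [hT, h]
      rw [this, measure_empty]
  rw [Measure.real, h1, ← integral_toReal (by exact (hmeas.comp hV).aemeasurable)
    (Filter.Eventually.of_forall fun ω => measure_lt_top _ _)]
  rfl

/-- Given `U ∘ V`, an event of `m₁` depends only on `Z`, which is independent of `V` and therefore
of all of `m₂`. This is the only source of conditional independence in the proof. -/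
theorem condIndepGiven_of_indepFun (P : Measure Ω) [IsProbabilityMeasure P]
    {Z : Ω → E} {V : Ω → F} {U : F → G} (hZ : Measurable Z) (hV : Measurable V)
    (hU : Measurable U) (hZV : Z ⟂ᵢ[P] V)
    (hm : m = MeasurableSpace.comap (fun ω => U (V ω)) mG)
    (h₁ : m₁ ≤ MeasurableSpace.comap (fun ω => (Z ω, U (V ω))) inferInstance)
    (h₂ : m₂ ≤ MeasurableSpace.comap V inferInstance) : CondIndepGiven P m m₁ m₂ := by
  subst hm
  intro A B hA hB
  obtain ⟨A', hA', rfl⟩ := h₁ A hA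
  obtain ⟨B', hB', rfl⟩ := h₂ B hB
  have hle : MeasurableSpace.comap (fun ω => U (V ω)) mG ≤ mΩ := (hU.comp hV).comap_le
  have : IsProbabilityMeasure (P.map Z) := Measure.isProbabilityMeasure_map hZ.aemeasurable
  -- An explicit version of the conditional probability of the `m₁`-event: `Z` is integrated out
  -- with `U (V ω)` frozen.
  set h : Ω → ℝ := fun ω => (P.map Z).real ((fun z => (z, U (V ω))) ⁻¹' A') with hh
  have hsm : StronglyMeasurable[MeasurableSpace.comap (fun ω => U (V ω)) mG] h := by
    have h0 : Measurable fun u : G => (P.map Z).real ((fun z => (z, u)) ⁻¹' A') :=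
      (measurable_measure_prodMk_right hA').ennreal_toReal
    exact (h0.comp (comap_measurable _)).stronglyMeasurable
  have hbd : ∀ᵐ ω ∂P, ‖h ω‖ ≤ 1 := Filter.Eventually.of_forall fun ω => by
    rw [Real.norm_of_nonneg measureReal_nonneg]
    exact measureReal_le_one
  have hAm : MeasurableSet ((fun ω => (Z ω, U (V ω))) ⁻¹' A') :=
    (hZ.prodMk (hU.comp hV)) hA'
  have key : ∀ C : Set F, MeasurableSet C →
      P⟦(fun ω => (Z ω, U (V ω))) ⁻¹' A' ∩ V ⁻¹' C | MeasurableSpace.comap (fun ω => U (V ω)) mG⟧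
        =ᵐ[P] h * P⟦V ⁻¹' C | MeasurableSpace.comap (fun ω => U (V ω)) mG⟧ := by
    intro C hC
    have hint : Integrable ((V ⁻¹' C).indicator fun _ => (1 : ℝ)) P :=
      (integrable_const _).indicator (hV hC)
    have hhint : Integrable (h * (V ⁻¹' C).indicator fun _ => (1 : ℝ)) P :=
      hint.bdd_mul (hsm.mono hle).aestronglyMeasurable hbd
    refine Filter.EventuallyEq.trans ?_
      (condExp_stronglyMeasurable_mul_of_bound hle hsm hint 1 hbd)
    symm
    refine ae_eq_condExp_of_forall_setIntegral_eq hle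
      ((integrable_const _).indicator (hAm.inter (hV hC)))
      (fun s _ _ => integrable_condExp.integrableOn) ?_
      stronglyMeasurable_condExp.aestronglyMeasurable
    rintro _ ⟨D, hD, rfl⟩ -
    have hDm : MeasurableSet ((fun ω => U (V ω)) ⁻¹' D) := (hU.comp hV) hD
    rw [setIntegral_condExp hle hhint ⟨D, hD, rfl⟩,
      setIntegral_indicator (hAm.inter (hV hC)), setIntegral_const, smul_eq_mul, mul_one]
    have e1 : (h * (V ⁻¹' C).indicator fun _ => (1 : ℝ)) = (V ⁻¹' C).indicator h := by
      ext ω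
      by_cases hω : ω ∈ V ⁻¹' C <;> simp [hω]
    rw [e1, setIntegral_indicator (hV hC)]
    have := measureReal_inter_preimage_of_indepFun P hZ hV hU hZV hA' ((hU hD).inter hC)
    rw [Set.preimage_inter] at this
    rw [show (fun ω => U (V ω)) ⁻¹' D ∩ V ⁻¹' C = V ⁻¹' (U ⁻¹' D) ∩ V ⁻¹' C from rfl, ← this]
    congr 1
    ext ω
    simp only [Set.mem_inter_iff, Set.mem_preimage]
    tauto
  have k1 := key B' hB'
  -- Taking the whole space identifies `h` with the conditional probability of the `m₁`-event.
  have k2 := key Set.univ MeasurableSet.univ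
  have e1 : P⟦V ⁻¹' Set.univ | MeasurableSpace.comap (fun ω => U (V ω)) mG⟧ = fun _ => 1 := by
    rw [Set.preimage_univ, Set.indicator_univ, condExp_const hle]
  rw [e1, Set.preimage_univ, Set.inter_univ] at k2
  filter_upwards [k1, k2] with ω h1 h2
  simp only [Pi.mul_apply, mul_one] at h1 h2 ⊢
  rw [h1, h2]

end Freezing

/-- Conditional independence makes the innovation of `f` given `m` uncorrelated with
every square integrable `m₂`-measurable `g`. -/
theorem CondIndepGiven.integral_mul_sub_condExp {Ω : Type*}
    {m m₁ m₂ : MeasurableSpace Ω} {mΩ : MeasurableSpace Ω} {P : Measure Ω}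
    [IsProbabilityMeasure P]
    (h : CondIndepGiven P m m₁ m₂) (hm : m ≤ mΩ) (h₁ : m₁ ≤ mΩ) (h₂ : m₂ ≤ mΩ)
    {f g : Ω → ℝ} (hf : StronglyMeasurable[m₁] f) (hg : StronglyMeasurable[m₂] g)
    (hf2 : MemLp f 2 P) (hg2 : MemLp g 2 P) :
    ∫ ω, g ω * (f ω - (P[f | m]) ω) ∂P = 0 := by
  have hfi : Integrable f P := hf2.integrable one_le_two
  have hξ2 : MemLp (P[f | m]) 2 P := hf2.condExp one_le_two
  have key : ∀ B, MeasurableSet[m₂] B → ∫ ω in B, (f - P[f | m]) ω ∂P = 0 := by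
    intro B hB
    have hBm := h₂ B hB
    set u : Ω → ℝ := B.indicator fun _ => 1 with hu
    have hui : Integrable u P := (integrable_const _).indicator hBm
    have hu2 : MemLp u 2 P := memLp_indicator_const 2 hBm 1 (Or.inr (measure_ne_top _ _))
    have hp2 : MemLp (P[u | m]) 2 P := hu2.condExp one_le_two
    -- Tested against `A` in `m₁`: conditional independence makes the conditional expectations given
    -- `m` of `1_A P[u | m]` and of `1_A u` agree.
    have hg0 : P[u - P[u | m] | m₁] =ᵐ[P] fun _ => 0 := by
      symm
      refine ae_eq_condExp_of_forall_setIntegral_eq h₁ (hui.sub integrable_condExp)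
        (fun s _ _ => integrable_zero _ _ _ |>.integrableOn) ?_
        stronglyMeasurable_const.aestronglyMeasurable
      intro A hA _
      have hAm := h₁ A hA
      have hai : Integrable (A.indicator fun _ => (1 : ℝ)) P := (integrable_const _).indicator hAm
      have ha2 : MemLp (A.indicator fun _ => (1 : ℝ)) 2 P :=
        memLp_indicator_const 2 hAm 1 (Or.inr (measure_ne_top _ _))
      have e1 : ∫ ω in A, (P[u | m]) ω ∂P =
          ∫ ω, (A.indicator (fun _ => (1 : ℝ)) * P[u | m]) ω ∂P := by
        rw [← integral_indicator hAm]
        congr 1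
        ext ω
        by_cases hω : ω ∈ A <;> simp [hω]
      have hap : Integrable (A.indicator (fun _ => (1 : ℝ)) * P[u | m]) P :=
        ha2.integrable_mul hp2
      have e2 := condExp_mul_of_stronglyMeasurable_right (μ := P) (m := m)
        stronglyMeasurable_condExp hap hai
      have e3 : ∫ ω in A, (P[u | m]) ω ∂P = ∫ ω in A, u ω ∂P := by
        rw [e1, ← integral_condExp hm, integral_congr_ae (e2.trans (h A B hA hB).symm),
          integral_condExp hm, hu, integral_indicator (hAm.inter hBm),
          setIntegral_indicator hBm]
      simp only [integral_zero, Pi.sub_apply]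
      rw [integral_sub hui.integrableOn integrable_condExp.integrableOn, e3, sub_self]
    have hfu : Integrable (f * (u - P[u | m])) P := hf2.integrable_mul (hu2.sub hp2)
    have i1 : ∫ ω, (f * (u - P[u | m])) ω ∂P = 0 := by
      rw [← integral_condExp h₁, integral_congr_ae (condExp_mul_of_stronglyMeasurable_left hf hfu
        (hui.sub integrable_condExp))]
      refine integral_eq_zero_of_ae ?_
      filter_upwards [hg0] with ω hω
      simp [hω]
    -- Conditional expectation is self-adjoint on `L²`, which moves it from `u` to `f`.
    have i2 : ∫ ω, (f * P[u | m]) ω ∂P = ∫ ω, (P[f | m] * u) ω ∂P := by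
      rw [← integral_condExp hm, integral_congr_ae (condExp_mul_of_stronglyMeasurable_right
        stronglyMeasurable_condExp (hf2.integrable_mul hp2) hfi),
        ← integral_condExp hm (f := P[f | m] * u),
        integral_congr_ae (condExp_mul_of_stronglyMeasurable_left
        stronglyMeasurable_condExp (hξ2.integrable_mul hu2) hui)]
    rw [← integral_indicator hBm]
    have e4 : B.indicator (f - P[f | m]) = f * (u - P[u | m]) + (f * P[u | m] - P[f | m] * u) := by
      ext ω
      by_cases hω : ω ∈ B <;> simp [hu, hω]
      ring
    rw [e4, integral_add' hfu ((hf2.integrable_mul hp2).sub (hξ2.integrable_mul hu2)), i1,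
      integral_sub' (hf2.integrable_mul hp2) (hξ2.integrable_mul hu2), i2]
    simp
  have hz : P[f - P[f | m] | m₂] =ᵐ[P] fun _ => 0 := by
    symm
    refine ae_eq_condExp_of_forall_setIntegral_eq h₂ (hfi.sub integrable_condExp)
      (fun s _ _ => integrable_zero _ _ _ |>.integrableOn) ?_
      stronglyMeasurable_const.aestronglyMeasurable
    intro B hB _
    rw [key B hB]
    simp
  change ∫ ω, (g * (f - P[f | m])) ω ∂P = 0
  rw [← integral_condExp h₂, integral_congr_ae (condExp_mul_of_stronglyMeasurable_left hg
    (hg2.integrable_mul (hf2.sub hξ2)) (hfi.sub integrable_condExp))]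
  refine integral_eq_zero_of_ae ?_
  filter_upwards [hz] with ω hω
  simp [hω]

end CMSequence

/-! ### Gaussian families: conditional independence as zeros of the precision matrix. -/

namespace CMSequence

section Gaussian

variable {Ω I : Type*}

theorem iSup_comap_eq_comap_pi {β : I → Type*} [∀ i, MeasurableSpace (β i)]
    (X : ∀ i, Ω → β i) (S : Set I) :
    ⨆ i ∈ S, MeasurableSpace.comap (X i) inferInstance =
      MeasurableSpace.comap (fun ω (i : S) => X i ω) inferInstance := by
  rw [MeasurableSpace.pi, MeasurableSpace.comap_iSup, iSup_subtype']
  simp only [MeasurableSpace.comap_comp]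
  rfl

variable [mΩ : MeasurableSpace Ω] [Fintype I] {P : Measure Ω} {X : I → Ω → ℝ}

theorem isGaussianProcess_linearCombination (hX : IsGaussianProcess X P) {K : Type*}
    (B : K → I → ℝ) : IsGaussianProcess (fun k ω => ∑ j, B k j * X j ω) P := by
  refine hX.of_isGaussianProcess fun k => ⟨Finset.univ,
    ∑ j, B k j • ContinuousLinearMap.proj (R := ℝ) (φ := fun _ => ℝ)
      (⟨j, Finset.mem_univ j⟩ : (Finset.univ : Finset I)), fun ω => ?_⟩
  simp

theorem memLp_linearCombination (hX : IsGaussianProcess X P) (v : I → ℝ) :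
    MemLp (fun ω => ∑ j, v j * X j ω) 2 P :=
  memLp_finsetSum _ fun j _ => (hX.hasGaussianLaw_eval j).memLp_two.const_mul _

theorem covariance_linearCombination_left (hX : IsGaussianProcess X P) (v : I → ℝ)
    {Y : Ω → ℝ} (hY : MemLp Y 2 P) [IsFiniteMeasure P] :
    cov[fun ω => ∑ j, v j * X j ω, Y; P] = ∑ j, v j * cov[X j, Y; P] := by
  rw [covariance_fun_sum_left (fun j => (hX.hasGaussianLaw_eval j).memLp_two.const_mul _) hY]
  simp only [covariance_const_mul_left]

theorem covariance_linearCombination (hX : IsGaussianProcess X P) (v w : I → ℝ)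
    [IsFiniteMeasure P] :
    cov[fun ω => ∑ j, v j * X j ω, fun ω => ∑ j, w j * X j ω; P] =
      v ⬝ᵥ (Matrix.of fun i j => cov[X i, X j; P]) *ᵥ w := by
  rw [covariance_linearCombination_left hX v (memLp_linearCombination hX w)]
  refine Finset.sum_congr rfl fun i _ => ?_
  rw [covariance_comm, covariance_linearCombination_left hX w
    (hX.hasGaussianLaw_eval i).memLp_two]
  congr 1
  refine Finset.sum_congr rfl fun j _ => ?_
  simp [mul_comm, covariance_comm]

theorem posSemidef_covariance (hX : IsGaussianProcess X P) [IsProbabilityMeasure P] :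
    (Matrix.of fun i j => cov[X i, X j; P]).PosSemidef := by
  refine PosSemidef.of_dotProduct_mulVec_nonneg ?_ fun v => ?_
  · ext i j
    simp [covariance_comm]
  · rw [star_trivial, ← covariance_linearCombination hX v v,
      covariance_self (memLp_linearCombination hX v).aemeasurable]
    exact variance_nonneg _ _

theorem indepFun_linearCombination (hX : IsGaussianProcess X P) {K K' : Type*}
    (B : K → I → ℝ) (B' : K' → I → ℝ)
    (h : ∀ k k', cov[fun ω => ∑ j, B k j * X j ω, fun ω => ∑ j, B' k' j * X j ω; P] = 0) :
    (fun ω k => ∑ j, B k j * X j ω) ⟂ᵢ[P] (fun ω k => ∑ j, B' k j * X j ω) := by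
  refine IsGaussianProcess.indepFun_of_covariance_eq_zero
    (X := fun k ω => ∑ j, B k j * X j ω) (Y := fun k ω => ∑ j, B' k j * X j ω) ?_
    (fun k => (memLp_linearCombination hX _).aemeasurable)
    (fun k => (memLp_linearCombination hX _).aemeasurable) h
  convert! isGaussianProcess_linearCombination hX (Sum.elim B B') using 1
  ext k ω
  cases k <;> rfl

/-- For a centred Gaussian family with precision matrix `A`, conditional independence of two
complementary groups given the remaining variables means that a block of `A` vanishes. -/
theorem condIndepGiven_iff_precision_eq_zero [DecidableEq I] [IsProbabilityMeasure P]
    (hX : IsGaussianProcess X P) (hmeas : ∀ i, Measurable (X i)) (hzero : ∀ i, ∫ ω, X i ω ∂P = 0)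
    {A : Matrix I I ℝ} (hA : A.PosDef) (hAC : A * (Matrix.of fun i j => cov[X i, X j; P]) = 1)
    {S T U : Set I} (hST : Disjoint S T) (hSU : Disjoint S U) (hTU : Disjoint T U)
    (hun : S ∪ T ∪ U = Set.univ) :
    CondIndepGiven P (⨆ i ∈ U, MeasurableSpace.comap (X i) inferInstance)
      (⨆ i ∈ S, MeasurableSpace.comap (X i) inferInstance)
      (⨆ i ∈ T, MeasurableSpace.comap (X i) inferInstance) ↔
      ∀ s ∈ S, ∀ t ∈ T, A s t = 0 := by
  classical
  have hL2 : ∀ i, MemLp (X i) 2 P := fun i => (hX.hasGaussianLaw_eval i).memLp_two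
  have hle : ∀ R : Set I, ⨆ i ∈ R, MeasurableSpace.comap (X i) inferInstance ≤ mΩ :=
    fun R => iSup₂_le fun i _ => (hmeas i).comap_le
  -- The variables `z_i = ∑ k, A i k * X k` are dual to the `X j`. Being jointly Gaussian with them,
  -- the `z_i` with `i ∈ R` are independent of the `X j` with `j ∈ R'` whenever `R` and `R'` are
  -- disjoint.
  have hzX : ∀ i j, cov[fun ω => ∑ k, A i k * X k ω, X j; P] = if i = j then 1 else 0 := by
    intro i j
    rw [covariance_linearCombination_left hX _ (hL2 j)]
    have := congrFun (congrFun hAC i) j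
    rw [one_apply] at this
    rw [← this]
    rfl
  have hsingle : ∀ j, X j = fun ω => ∑ k, (Pi.single j (1 : ℝ) : I → ℝ) k * X k ω := by
    intro j
    ext ω
    simp [Pi.single_apply]
  have hindep : ∀ R R' : Set I, Disjoint R R' →
      (fun ω (k : R) => ∑ j, A k j * X j ω) ⟂ᵢ[P] (fun ω (k : R') => X k ω) := by
    intro R R' hRR'
    have := indepFun_linearCombination hX (fun k : R => A k)
      (fun k : R' => (Pi.single (k : I) (1 : ℝ) : I → ℝ)) (fun k k' => by
        rw [← hsingle, hzX, if_neg fun h : (k : I) = k' => Set.disjoint_left.1 hRR' k.2 (h ▸ k'.2)])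
    convert! this using 3 with ω k
    exact congrFun (hsingle k) ω
  have hmem : ∀ i, i ∈ S ∨ i ∈ T ∨ i ∈ U := fun i => by
    have : i ∈ S ∪ T ∪ U := hun ▸ Set.mem_univ i
    simpa [or_assoc] using this
  constructor
  · intro hCI
    set ξ : I → Ω → ℝ :=
      fun s => P[X s | ⨆ i ∈ U, MeasurableSpace.comap (X i) inferInstance] with hξdef
    have hXm : ∀ R : Set I, ∀ i ∈ R,
        StronglyMeasurable[⨆ i ∈ R, MeasurableSpace.comap (X i) inferInstance] (X i) := by
      intro R i hi
      refine Measurable.stronglyMeasurable ?_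
      exact Measurable.mono (comap_measurable (X i))
        (le_iSup₂_of_le (f := fun i (_ : i ∈ R) => MeasurableSpace.comap (X i) inferInstance)
          i hi le_rfl) le_rfl
    intro s hs t ht
    -- Covariances with the innovation of `X s` given `U`. For `s ∈ S` they vanish off `S`: on `T`
    -- by conditional independence, on `U` by the projection property. No formula for Gaussian
    -- conditional expectations is needed.
    set γ : I → I → ℝ := fun s j => ∫ ω, X j ω * (X s ω - ξ s ω) ∂P with hγ
    have hξ : ∀ s, MemLp (ξ s) 2 P := fun s => (hL2 s).condExp one_le_two
    have hγ0 : ∀ s ∈ S, ∀ j ∉ S, γ s j = 0 := by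
      intro s hs j hj
      rcases (hmem j).resolve_left hj with hj | hj
      · exact hCI.integral_mul_sub_condExp (hle U) (hle S) (hle T) (hXm S s hs) (hXm T j hj)
          (hL2 s) (hL2 j)
      · have hi : Integrable (X s) P := (hL2 s).integrable one_le_two
        have h1 : ∫ ω, (X j * X s) ω ∂P = ∫ ω, (X j * ξ s) ω ∂P := by
          rw [← integral_condExp (hle U), integral_congr_ae
            (condExp_mul_of_stronglyMeasurable_left (hXm U j hj)
              ((hL2 j).integrable_mul (hL2 s)) hi)]
        have h2 : (fun ω => X j ω * (X s ω - ξ s ω)) =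
            X j * X s - X j * ξ s := by
          ext ω
          simp [mul_sub]
        simp only [hγ]
        rw [h2, integral_sub' ((hL2 j).integrable_mul (hL2 s))
          ((hL2 j).integrable_mul (hξ s)), h1, sub_self]
    -- For `i ∉ U` the dual variable `z_i` is independent of the `X j`, `j ∈ U`, hence of `ξ s`, so
    -- only its covariance with `X s` survives.
    have hAγ : ∀ i ∉ U, ∀ s, ∑ j, A i j * γ s j = if i = s then 1 else 0 := by
      intro i hi s
      set z : Ω → ℝ := fun ω => ∑ j, A i j * X j ω with hz
      have hz2 : MemLp z 2 P := memLp_linearCombination hX _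
      have hz0 : ∫ ω, z ω ∂P = 0 := by
        rw [hz, integral_finsetSum _ fun j _ => ((hL2 j).integrable one_le_two).const_mul _]
        simp [integral_const_mul, hzero]
      have h1 : ∑ j, A i j * γ s j = ∫ ω, z ω * (X s ω - ξ s ω) ∂P := by
        simp only [hz, Finset.sum_mul, mul_assoc]
        rw [integral_finsetSum]
        · simp only [integral_const_mul, hγ]
        · exact fun j _ => ((hL2 j).integrable_mul ((hL2 s).sub (hξ s))).const_mul _
      have h2 : ∫ ω, (z * X s) ω ∂P = if i = s then 1 else 0 := by
        rw [← hzX i s, covariance_eq_sub hz2 (hL2 s), hz0, zero_mul, sub_zero]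
      have h3 : ∫ ω, (z * ξ s) ω ∂P = 0 := by
        have hind := hindep {i} U (Set.disjoint_singleton_left.2 hi)
        have hind2 : z ⟂ᵢ[P] (ξ s) := by
          rw [IndepFun_iff_Indep] at hind ⊢
          refine indep_of_indep_of_le_right (indep_of_indep_of_le_left hind ?_) ?_
          · rw [← measurable_iff_comap_le]
            exact (measurable_pi_apply (⟨i, rfl⟩ : ({i} : Set I))).comp
              (comap_measurable fun ω (k : ({i} : Set I)) => ∑ j, A k j * X j ω)
          · rw [← measurable_iff_comap_le]
            have : Measurable[⨆ i ∈ U, MeasurableSpace.comap (X i) inferInstance] (ξ s) :=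
              stronglyMeasurable_condExp.measurable
            rwa [iSup_comap_eq_comap_pi] at this
        rw [hind2.integral_mul_eq_mul_integral hz2.aestronglyMeasurable
          (hξ s).aestronglyMeasurable, hz0, zero_mul]
      have h4 : (fun ω => z ω * (X s ω - ξ s ω)) = z * X s - z * ξ s := by
        ext ω
        simp [mul_sub]
      rw [h1, h4, integral_sub' (hz2.integrable_mul (hL2 s)) (hz2.integrable_mul (hξ s)), h2, h3,
        sub_zero]
    -- In blocks, `A_SS γ_SS = 1` and `A_TS γ_SS = 0`, which forces `A_TS = 0`. Here row `t` on `S`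
    -- is written as a combination `w` of the rows of `A_SS`, and pairing with `γ` shows `w = 0`.
    obtain ⟨w, hw0, hw⟩ := exists_vecMul_eq_on hA S (A t)
    have hws : ∀ s ∈ S, w s = 0 := by
      intro s hs
      have e1 : ∑ i, w i * ∑ j, A i j * γ s j = w s := by
        rw [Finset.sum_eq_single s]
        · rw [hAγ s (Set.disjoint_left.1 hSU hs), if_pos rfl, mul_one]
        · intro i _ his
          by_cases hi : i ∈ S
          · rw [hAγ i (Set.disjoint_left.1 hSU hi), if_neg his, mul_zero]
          · rw [hw0 i hi, zero_mul]
        · simp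
      have e2 : ∑ i, w i * ∑ j, A i j * γ s j = ∑ j, A t j * γ s j := by
        simp only [Finset.mul_sum]
        rw [Finset.sum_comm]
        refine Finset.sum_congr rfl fun j _ => ?_
        by_cases hj : j ∈ S
        · rw [← hw j hj, vecMul, dotProduct, Finset.sum_mul]
          exact Finset.sum_congr rfl fun i _ => (mul_assoc _ _ _).symm
        · simp [hγ0 s hs j hj]
      rw [← e1, e2, hAγ t (Set.disjoint_left.1 hTU ht),
        if_neg fun h : t = s => Set.disjoint_left.1 hST hs (h ▸ ht)]
    have hw' : w = 0 := by
      ext i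
      by_cases hi : i ∈ S
      · exact hws i hi
      · exact hw0 i hi
    have := hw s hs
    rw [hw', zero_vecMul] at this
    have hsymm := hA.1.apply s t
    rw [star_trivial] at hsymm
    rw [← hsymm, ← this, Pi.zero_apply]
  · intro hA0
    have hUS : ∀ u : U, (u : I) ∈ Sᶜ := fun u => Set.disjoint_right.1 hSU u.2
    have hTS : ∀ u ∈ T, u ∈ Sᶜ := fun u hu => Set.disjoint_right.1 hST hu
    refine condIndepGiven_of_indepFun P (Z := fun ω (k : S) => ∑ j, A k j * X j ω)
      (V := fun ω (k : (Sᶜ : Set I)) => X k ω)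
      (U := fun v (u : U) => v ⟨u, hUS u⟩)
      (measurable_pi_lambda _ fun k => Finset.measurable_sum _ fun j _ =>
        (hmeas j).const_mul _)
      (measurable_pi_lambda _ fun k => hmeas k)
      (measurable_pi_lambda _ fun u => measurable_pi_apply _)
      (hindep S Sᶜ disjoint_compl_right) (iSup_comap_eq_comap_pi X U) ?_ ?_
    · refine iSup₂_le fun s hs => ?_
      -- As `A_ST = 0`, the relation `z_S = A_SS X_S + A_SU X_U` can be solved for `X s` in terms of
      -- `z_S` and `X_U`; `w` is the row of `A_SS⁻¹` that does it.
      obtain ⟨w, hw0, hw⟩ := exists_vecMul_eq_on hA S (Pi.single s 1)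
      rw [← measurable_iff_comap_le]
      set φ : (S → ℝ) × (U → ℝ) → ℝ := fun p =>
        ∑ i, (if h : i ∈ S then w i * p.1 ⟨i, h⟩ else 0) -
          ∑ i, (if h : i ∈ U then (w ᵥ* A) i * p.2 ⟨i, h⟩ else 0) with hφ
      have hφm : Measurable φ := by
        refine (Finset.measurable_sum _ fun i _ => ?_).sub (Finset.measurable_sum _ fun i _ => ?_)
        · split_ifs
          · exact ((measurable_pi_apply _).comp measurable_fst).const_mul _
          · exact measurable_const
        · split_ifs
          · exact ((measurable_pi_apply _).comp measurable_snd).const_mul _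
          · exact measurable_const
      have hXs : X s = fun ω => φ (fun k : S => ∑ j, A k j * X j ω, fun u : U => X u ω) := by
        ext ω
        simp only [hφ]
        have e1 : ∑ i, (if h : i ∈ S then w i * ∑ j, A i j * X j ω else 0) =
            ∑ j, (w ᵥ* A) j * X j ω := by
          simp only [vecMul, dotProduct, Finset.sum_mul]
          rw [Finset.sum_comm]
          refine Finset.sum_congr rfl fun i _ => ?_
          by_cases hi : i ∈ S
          · simp [hi, Finset.mul_sum, mul_assoc]
          · simp [hi, hw0 i hi]
        rw [e1, ← Finset.sum_sub_distrib, Finset.sum_eq_single s]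
        · have : s ∉ U := Set.disjoint_left.1 hSU hs
          simp [this, hw s hs]
        · intro i _ his
          rcases hmem i with hi | hi | hi
          · have : i ∉ U := Set.disjoint_left.1 hSU hi
            simp [this, hw i hi, his]
          · have : i ∉ U := Set.disjoint_left.1 hTU hi
            have h0 : (w ᵥ* A) i = 0 := by
              refine Finset.sum_eq_zero fun j _ => ?_
              by_cases hj : j ∈ S
              · simp [hA0 j hj i hi]
              · simp [hw0 j hj]
            simp [this, h0]
          · simp [hi]
        · simp
      rw [hXs]
      exact hφm.comp (comap_measurable _)
    · refine iSup₂_le fun t ht => ?_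
      rw [← measurable_iff_comap_le]
      exact (measurable_pi_apply (⟨t, hTS t ht⟩ : (Sᶜ : Set I))).comp
        (comap_measurable fun ω (k : (Sᶜ : Set I)) => X k ω)

end Gaussian

end CMSequence

/-! ### Block precision matrix of a sequence; Markov and reciprocal as sparsity. -/

namespace CMSequence

variable {Ω : Type*} {N d : ℕ} {x : Fin (N + 1) → Ω → (Fin d → ℝ)}

theorem sigmaOf_eq (S : Set (Fin (N + 1))) :
    sigmaOf x S = ⨆ p ∈ {p : Fin (N + 1) × Fin d | p.1 ∈ S},
      MeasurableSpace.comap (fun ω => x p.1 ω p.2) inferInstance := by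
  simp only [sigmaOf, MeasurableSpace.pi, MeasurableSpace.comap_iSup, MeasurableSpace.comap_comp,
    Set.mem_ofPred_eq, iSup_prod]
  refine iSup_congr fun k => ?_
  rw [iSup_comm]
  rfl

variable [MeasurableSpace Ω] {P : Measure Ω}

/-- The covariance of the whole sequence as a matrix of blocks. -/
noncomputable def blockCov (P : Measure Ω) (x : Fin (N + 1) → Ω → (Fin d → ℝ)) :
    Matrix (Fin (N + 1)) (Fin (N + 1)) (Matrix (Fin d) (Fin d) ℝ) :=
  Matrix.of fun k l => crossCov P (x k) (x l)

theorem isGaussianProcess_coord (hx : IsGaussianProcess x P) :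
    IsGaussianProcess (fun (p : Fin (N + 1) × Fin d) ω => x p.1 ω p.2) P :=
  hx.of_isGaussianProcess fun p => ⟨{p.1},
    (ContinuousLinearMap.proj (R := ℝ) (φ := fun _ : Fin d => ℝ) p.2).comp
      (ContinuousLinearMap.proj (R := ℝ) (φ := fun _ => Fin d → ℝ)
        (⟨p.1, Finset.mem_singleton_self _⟩ : ({p.1} : Finset (Fin (N + 1))))),
    fun ω => by simp⟩

theorem isGaussianProcess_sum_mulVec (hx : IsGaussianProcess x P)
    (L : Matrix (Fin (N + 1)) (Fin (N + 1)) (Matrix (Fin d) (Fin d) ℝ)) :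
    IsGaussianProcess (fun k ω => ∑ j, L k j *ᵥ x j ω) P := by
  refine hx.of_isGaussianProcess fun k => ⟨Finset.univ,
    ∑ j, (Matrix.mulVecLin (L k j)).toContinuousLinearMap.comp
      (ContinuousLinearMap.proj (R := ℝ) (φ := fun _ => Fin d → ℝ)
      (⟨j, Finset.mem_univ j⟩ : (Finset.univ : Finset (Fin (N + 1))))), fun ω => ?_⟩
  simp

theorem posDef_seqCov [IsProbabilityMeasure P] (hx : IsZMNG P x) : (seqCov P x).PosDef := by
  have h : (seqCov P x).PosSemidef := posSemidef_covariance (isGaussianProcess_coord hx.gaussian)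
  exact (h.posDef_iff_isUnit).2 ((isUnit_iff_isUnit_det _).2 hx.nonsingular.isUnit)

theorem comp_blockCov : Matrix.comp _ _ _ _ _ (blockCov P x) = seqCov P x := rfl

theorem integral_coord_eq_zero (hx : IsGaussianProcess x P) (h0 : ∀ k, ∫ ω, x k ω ∂P = 0)
    (p : Fin (N + 1) × Fin d) : ∫ ω, x p.1 ω p.2 ∂P = 0 := by
  have hi : Integrable (x p.1) P := (hx.hasGaussianLaw_eval p.1).integrable
  have := (ContinuousLinearMap.proj (R := ℝ) (φ := fun _ : Fin d => ℝ) p.2).integral_comp_comm hi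
  rw [h0] at this
  simpa using this

/-- The precision matrix of the sequence, in blocks. -/
noncomputable def precision (P : Measure Ω) (x : Fin (N + 1) → Ω → (Fin d → ℝ)) :
    Matrix (Fin (N + 1)) (Fin (N + 1)) (Matrix (Fin d) (Fin d) ℝ) :=
  (Matrix.comp _ _ _ _ _).symm (seqCov P x)⁻¹

theorem precision_mul_blockCov (hx : IsZMNG P x) : precision P x * blockCov P x = 1 := by
  apply (Matrix.compRingEquiv (Fin (N + 1)) (Fin d) ℝ).injective
  rw [map_mul, map_one, compRingEquiv_apply, compRingEquiv_apply, comp_blockCov, precision,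
    Equiv.apply_symm_apply, nonsing_inv_mul _ hx.nonsingular.isUnit]

theorem condIndepGiven_iff_precision [IsProbabilityMeasure P] (hx : IsZMNG P x)
    (hmeas : ∀ k, Measurable (x k)) {S T U : Set (Fin (N + 1))}
    (hST : Disjoint S T) (hSU : Disjoint S U) (hTU : Disjoint T U)
    (hun : S ∪ T ∪ U = Set.univ) :
    CondIndepGiven P (sigmaOf x U) (sigmaOf x S) (sigmaOf x T) ↔
      ∀ s ∈ S, ∀ t ∈ T, precision P x s t = 0 := by
  rw [sigmaOf_eq, sigmaOf_eq, sigmaOf_eq]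
  have hdisj : ∀ {Q R : Set (Fin (N + 1))}, Disjoint Q R →
      Disjoint {p : Fin (N + 1) × Fin d | p.1 ∈ Q} {p | p.1 ∈ R} :=
    fun h => Set.disjoint_left.2 fun p hp hp' => Set.disjoint_left.1 h hp hp'
  rw [condIndepGiven_iff_precision_eq_zero (isGaussianProcess_coord hx.gaussian)
    (fun p => (measurable_pi_apply p.2).comp (hmeas p.1))
    (integral_coord_eq_zero hx.gaussian hx.zero_mean) (posDef_seqCov hx).inv
    (nonsing_inv_mul _ hx.nonsingular.isUnit) (hdisj hST) (hdisj hSU) (hdisj hTU)]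
  · constructor
    · intro h s hs t ht
      ext a b
      exact h (s, a) hs (t, b) ht
    · intro h p hp q hq
      exact congrFun (congrFun (h p.1 hp q.1 hq) p.2) q.2
  · ext p
    have : p.1 ∈ S ∪ T ∪ U := hun ▸ Set.mem_univ _
    simpa using this

theorem precision_conjTranspose [IsProbabilityMeasure P] (hx : IsZMNG P x)
    (i j : Fin (N + 1)) : precision P x j i = (precision P x i j)ᵀ := by
  ext a b
  have := (posDef_seqCov hx).inv.1.apply (j, a) (i, b)
  rw [star_trivial] at this
  exact this.symm

theorem isMarkov_iff_precision [IsProbabilityMeasure P] (hx : IsZMNG P x)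
    (hmeas : ∀ k, Measurable (x k)) :
    IsMarkov P x ↔ ∀ i j : Fin (N + 1), (i : ℕ) + 2 ≤ j → precision P x i j = 0 := by
  have key : ∀ k : Fin (N + 1),
      CondIndepGiven P (sigmaOf x {k}) (sigmaOf x (Set.Iio k)) (sigmaOf x (Set.Ioi k)) ↔
        ∀ i < k, ∀ j > k, precision P x i j = 0 := fun k =>
    condIndepGiven_iff_precision hx hmeas
      (Set.disjoint_left.2 fun i (hi : i < k) (hj : k < i) => lt_asymm hi hj)
      (by simp) (by simp) (by
        ext i
        rcases lt_trichotomy i k with h | h | h <;> simp [h, em])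
  simp only [IsMarkov, key]
  constructor
  · intro h i j hij
    -- The time `i + 1` separates `i` from `j`.
    exact h ⟨i + 1, by omega⟩ i (Fin.lt_def.2 (by simp)) j (Fin.lt_def.2 (by simp; omega))
  · intro h k i hi j hj
    exact h i j (by have := Fin.lt_def.1 hi; have := Fin.lt_def.1 hj; omega)

theorem isReciprocal_iff_precision [IsProbabilityMeasure P] (hx : IsZMNG P x)
    (hmeas : ∀ k, Measurable (x k)) :
    IsReciprocal P x ↔ ∀ i j : Fin (N + 1), (i : ℕ) + 2 ≤ j → ¬ ((i : ℕ) = 0 ∧ (j : ℕ) = N) →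
      precision P x i j = 0 := by
  have key : ∀ k l : Fin (N + 1), k < l →
      (CondIndepGiven P (sigmaOf x {k, l}) (sigmaOf x (Set.Ioo k l)) (sigmaOf x (Set.Icc k l)ᶜ) ↔
        ∀ i ∈ Set.Ioo k l, ∀ j ∈ (Set.Icc k l)ᶜ, precision P x i j = 0) := fun k l hkl =>
    condIndepGiven_iff_precision hx hmeas
      (Set.disjoint_left.2 fun i hi hj => hj ⟨hi.1.le, hi.2.le⟩)
      (Set.disjoint_left.2 fun i hi hj => by
        rcases hj with rfl | rfl
        · exact lt_irrefl _ hi.1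
        · exact lt_irrefl _ hi.2)
      (Set.disjoint_left.2 fun i hi hj => by
        rcases hj with rfl | rfl
        · exact hi ⟨le_rfl, hkl.le⟩
        · exact hi ⟨hkl.le, le_rfl⟩) (by
        ext i
        simp only [Set.mem_union, Set.mem_Ioo, Set.mem_compl_iff, Set.mem_Icc,
          Set.mem_insert_iff, Set.mem_singleton_iff, Set.mem_univ, iff_true, Fin.lt_def,
          Fin.le_def, Fin.ext_iff]
        have := Fin.lt_def.1 hkl
        omega)
  constructor
  · intro h i j hij h0N
    -- An interior time is isolated by the interval between its two neighbours. Either `i` is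
    -- interior, or `i = 0` and then `j < N` is; only the pair `(0, N)` escapes.
    by_cases hi : (i : ℕ) = 0
    · have h1 := (key ⟨j - 1, by omega⟩ ⟨j + 1, by omega⟩ (Fin.lt_def.2 (by simp))).1
        (h _ _ (Fin.lt_def.2 (by simp))) j
        (by simp only [Set.mem_Ioo, Fin.lt_def]; omega) i
        (by simp only [Set.mem_compl_iff, Set.mem_Icc, Fin.le_def]; omega)
      rw [precision_conjTranspose hx j i, h1, transpose_zero]
    · exact (key ⟨i - 1, by omega⟩ ⟨i + 1, by omega⟩ (Fin.lt_def.2 (by simp))).1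
        (h _ _ (Fin.lt_def.2 (by simp))) i
        (by simp only [Set.mem_Ioo, Fin.lt_def]; omega) j
        (by simp only [Set.mem_compl_iff, Set.mem_Icc, Fin.le_def]; omega)
  · intro h k l hkl
    rw [key k l hkl]
    intro i hi j hj
    simp only [Set.mem_Ioo, Set.mem_compl_iff, Set.mem_Icc, Fin.lt_def, Fin.le_def] at hi hj
    rcases le_total (i : ℕ) j with hij | hij
    · exact h i j (by omega) (by omega)
    · rw [precision_conjTranspose hx j i, h j i (by omega) (by omega), transpose_zero]

theorem crossCov_sum_mulVec [IsProbabilityMeasure P] (hx : IsGaussianProcess x P)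
    (L : Matrix (Fin (N + 1)) (Fin (N + 1)) (Matrix (Fin d) (Fin d) ℝ)) (k l : Fin (N + 1)) :
    crossCov P (fun ω => ∑ j, L k j *ᵥ x j ω) (fun ω => ∑ j, L l j *ᵥ x j ω) =
      (L * blockCov P x * Lᴴ) k l := by
  have hcoord : ∀ k a ω, (∑ j, L k j *ᵥ x j ω) a =
      ∑ p : Fin (N + 1) × Fin d, L k p.1 a p.2 * x p.1 ω p.2 := by
    intro k a ω
    rw [Finset.sum_apply, Fintype.sum_prod_type]
    rfl
  ext a b
  simp only [crossCov, of_apply, hcoord]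
  rw [covariance_linearCombination (isGaussianProcess_coord hx)
    (fun p => L k p.1 a p.2) (fun p => L l p.1 b p.2)]
  have : (L * blockCov P x * Lᴴ) k l a b = (Matrix.compRingEquiv (Fin (N + 1)) (Fin d) ℝ
    (L * (blockCov P x * Lᴴ))) (k, a) (l, b) := by rw [mul_assoc]; rfl
  rw [this, map_mul, map_mul]
  rfl

theorem isWhiteGaussian_sum_mulVec_iff [IsProbabilityMeasure P] (hx : IsZMNG P x)
    (L : Matrix (Fin (N + 1)) (Fin (N + 1)) (Matrix (Fin d) (Fin d) ℝ))
    (V : Fin (N + 1) → Matrix (Fin d) (Fin d) ℝ) :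
    IsWhiteGaussian P (fun k ω => ∑ j, L k j *ᵥ x j ω) V ↔
      L * blockCov P x * Lᴴ = diagonal V ∧ ∀ k, (V k).det ≠ 0 := by
  constructor
  · intro h
    refine ⟨?_, h.nonsingular⟩
    ext1 k l
    rw [← crossCov_sum_mulVec hx.gaussian]
    by_cases hkl : k = l
    · subst hkl
      rw [diagonal_apply_eq]
      exact h.cov_eq k
    · rw [diagonal_apply_ne _ hkl]
      exact h.white k l hkl
  · rintro ⟨h, hV⟩
    refine ⟨isGaussianProcess_sum_mulVec hx.gaussian L, fun k => ?_, fun k l hkl => ?_,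
      fun k => ?_, hV⟩
    · have hi : ∀ j, Integrable (x j) P := fun j =>
        (hx.gaussian.hasGaussianLaw_eval j).integrable
      have hc : ∀ j, ∫ ω, L k j *ᵥ x j ω ∂P = 0 := fun j => by
        have := (Matrix.mulVecLin (L k j)).toContinuousLinearMap.integral_comp_comm (hi j)
        rw [hx.zero_mean, map_zero] at this
        exact this
      have hi' : ∀ j, Integrable (fun ω => L k j *ᵥ x j ω) P := fun j =>
        (Matrix.mulVecLin (L k j)).toContinuousLinearMap.integrable_comp (hi j)
      rw [integral_finsetSum _ fun j _ => hi' j]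
      simp [hc]
    · rw [crossCov_sum_mulVec hx.gaussian, h, diagonal_apply_ne _ hkl]
    · rw [crossCov_sum_mulVec hx.gaussian, h, diagonal_apply_eq]

theorem IsWhiteGaussian.congr {e e' : Fin (N + 1) → Ω → (Fin d → ℝ)}
    {V : Fin (N + 1) → Matrix (Fin d) (Fin d) ℝ} (h : IsWhiteGaussian P e V)
    (he : ∀ k, e k =ᵐ[P] e' k) : IsWhiteGaussian P e' V := by
  have hc : ∀ k l, crossCov P (e' k) (e' l) = crossCov P (e k) (e l) := by
    intro k l
    ext a b
    have h1 : ∀ k a, (fun ω => e' k ω a) =ᵐ[P] fun ω => e k ω a := fun k a => by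
      filter_upwards [he k] with ω hω
      rw [hω]
    simp only [crossCov, of_apply, covariance]
    rw [integral_congr_ae (h1 k a), integral_congr_ae (h1 l b)]
    refine integral_congr_ae ?_
    filter_upwards [h1 k a, h1 l b] with ω hk hl
    rw [hk, hl]
  exact ⟨h.gaussian.congr he, fun k => by rw [← integral_congr_ae (he k), h.zero_mean],
    fun k l hkl => by rw [hc, h.white k l hkl], fun k => by rw [hc, h.cov_eq], h.nonsingular⟩

end CMSequence

/-! ### Backward models as factorizations of the covariance. -/

namespace CMSequence

variable {Ω : Type*} {N d : ℕ}

theorem zero_ne_last (hN : 1 ≤ N) : (0 : Fin (N + 1)) ≠ Fin.last N := by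
  rw [Ne, Fin.ext_iff, Fin.val_zero, Fin.val_last]
  omega

/-- The coefficient of `x j` in the equation for `x k` of the backward model. -/
def modelCoef (c : Fin (N + 1)) (b : BoundaryForm) (M : BackwardParams N d) :
    Matrix (Fin (N + 1)) (Fin (N + 1)) (Matrix (Fin d) (Fin d) ℝ) :=
  Matrix.of fun k j =>
    if k ≠ c ∧ k ≠ Fin.last N then
      (if (j : ℕ) = k + 1 then M.G k j else 0) + (if j = c then M.G k j else 0)
    else
      match b with
      | .first => if c = 0 ∧ k = c ∧ j = Fin.last N then M.G k j else 0
      | .second => if c = 0 ∧ k = Fin.last N ∧ j = c then M.G k j else 0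

section Rows

variable {c : Fin (N + 1)} {b : BoundaryForm} (M : BackwardParams N d)
  (v : Fin (N + 1) → Fin d → ℝ)

theorem sum_ite_mulVec (l : Fin (N + 1)) (A : Fin (N + 1) → Matrix (Fin d) (Fin d) ℝ) :
    ∑ j, (if j = l then A j else 0) *ᵥ v j = A l *ᵥ v l := by
  rw [Finset.sum_eq_single l] <;> simp +contextual

theorem sum_modelCoef_castSucc {k : Fin N} (hk : k.castSucc ≠ c) :
    ∑ j, modelCoef c b M k.castSucc j *ᵥ v j =
      M.G k.castSucc k.succ *ᵥ v k.succ + M.G k.castSucc c *ᵥ v c := by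
  have h1 : ∀ j, modelCoef c b M k.castSucc j =
      (if j = k.succ then M.G k.castSucc j else 0) + (if j = c then M.G k.castSucc j else 0) := by
    intro j
    have h2 : j = k.succ ↔ (j : ℕ) = k + 1 := by rw [Fin.ext_iff, Fin.val_succ]
    simp [modelCoef, hk, (Fin.castSucc_lt_last k).ne, h2]
  simp only [h1, add_mulVec, Finset.sum_add_distrib, sum_ite_mulVec]

theorem sum_modelCoef_first_last (hN : 1 ≤ N) :
    ∑ j, modelCoef c .first M (Fin.last N) j *ᵥ v j = 0 := by
  refine Finset.sum_eq_zero fun j _ => ?_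
  have : ¬ (c = 0 ∧ Fin.last N = c ∧ j = Fin.last N) := by
    rintro ⟨rfl, h, -⟩
    exact zero_ne_last hN h.symm
  simp [modelCoef, this]

theorem sum_modelCoef_first_zero :
    ∑ j, modelCoef (0 : Fin (N + 1)) .first M 0 j *ᵥ v j =
      M.G 0 (Fin.last N) *ᵥ v (Fin.last N) := by
  simp [modelCoef, sum_ite_mulVec]

theorem sum_modelCoef_second_self (hN : 1 ≤ N) :
    ∑ j, modelCoef c .second M c j *ᵥ v j = 0 := by
  refine Finset.sum_eq_zero fun j _ => ?_
  have : ¬ (c = 0 ∧ c = Fin.last N ∧ j = c) := by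
    rintro ⟨rfl, h, -⟩
    exact zero_ne_last hN h
  simp [modelCoef, this]

theorem sum_modelCoef_second_last :
    ∑ j, modelCoef (0 : Fin (N + 1)) .second M (Fin.last N) j *ᵥ v j =
      M.G (Fin.last N) 0 *ᵥ v 0 := by
  simp [modelCoef, sum_ite_mulVec]

end Rows

variable [MeasurableSpace Ω] {P : Measure Ω} {x : Fin (N + 1) → Ω → (Fin d → ℝ)}

theorem governedBy_iff_exists (hN : 1 ≤ N) {c : Fin (N + 1)} (hc : c = 0 ∨ c = Fin.last N)
    (b : BoundaryForm) (M : BackwardParams N d) :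
    GovernedBy P x c b M ↔ ∃ e : Fin (N + 1) → Ω → (Fin d → ℝ), IsWhiteGaussian P e M.V ∧
      ∀ k, ∀ᵐ ω ∂P, x k ω = ∑ j, modelCoef c b M k j *ᵥ x j ω + e k ω := by
  have h0N : (0 : Fin (N + 1)) ≠ Fin.last N := zero_ne_last hN
  refine exists_congr fun e => and_congr_right fun _ => ?_
  have hrow : (∀ k, ∀ᵐ ω ∂P, x k ω = ∑ j, modelCoef c b M k j *ᵥ x j ω + e k ω) ↔
      (∀ k : Fin N, k.castSucc ≠ c → ∀ᵐ ω ∂P, x k.castSucc ω =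
        M.G k.castSucc k.succ *ᵥ x k.succ ω + M.G k.castSucc c *ᵥ x c ω + e k.castSucc ω) ∧
      (∀ᵐ ω ∂P, x c ω = ∑ j, modelCoef c b M c j *ᵥ x j ω + e c ω) ∧
      (∀ᵐ ω ∂P, x (Fin.last N) ω =
        ∑ j, modelCoef c b M (Fin.last N) j *ᵥ x j ω + e (Fin.last N) ω) := by
    constructor
    · intro h
      refine ⟨fun k hk => ?_, h c, h _⟩
      filter_upwards [h k.castSucc] with ω hω
      rwa [sum_modelCoef_castSucc M _ hk] at hω
    · rintro ⟨h1, h2, h3⟩ k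
      by_cases hkc : k = c
      · exact hkc ▸ h2
      · induction k using Fin.lastCases with
        | last => exact h3
        | cast k =>
          filter_upwards [h1 k hkc] with ω hω
          rwa [sum_modelCoef_castSucc M _ hkc]
  rw [hrow]
  refine and_congr_right fun _ => ?_
  rcases hc with rfl | rfl <;> cases b
  · simp only [BoundaryCondition, sum_modelCoef_first_zero, sum_modelCoef_first_last M _ hN,
      zero_add, forall_const]
    exact and_comm
  · simp only [BoundaryCondition, sum_modelCoef_second_self M _ hN, sum_modelCoef_second_last,
      zero_add, forall_const]
  · simp only [BoundaryCondition, sum_modelCoef_first_last M _ hN, zero_add, h0N.symm,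
      false_imp_iff, and_true, and_self]
  · simp only [BoundaryCondition, sum_modelCoef_second_self M _ hN, zero_add, h0N.symm,
      false_imp_iff, and_true, and_self]

/-- The model equations determine the noise almost surely as `e = (1 - modelCoef c b M) x`, so the
only question is whether this linear image of `x` is white with covariances `M.V`. -/
theorem governedBy_iff_covariance [IsProbabilityMeasure P] (hx : IsZMNG P x) (hN : 1 ≤ N)
    {c : Fin (N + 1)} (hc : c = 0 ∨ c = Fin.last N) (b : BoundaryForm)
    (M : BackwardParams N d) :
    GovernedBy P x c b M ↔
      (1 - modelCoef c b M) * blockCov P x * (1 - modelCoef c b M)ᴴ = diagonal M.V ∧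
        ∀ k, (M.V k).det ≠ 0 := by
  rw [governedBy_iff_exists hN hc, ← isWhiteGaussian_sum_mulVec_iff hx]
  have hL : ∀ k ω, ∑ j, (1 - modelCoef c b M) k j *ᵥ x j ω =
      x k ω - ∑ j, modelCoef c b M k j *ᵥ x j ω := by
    intro k ω
    simp only [Matrix.sub_apply, sub_mulVec, Finset.sum_sub_distrib]
    congr 1
    rw [Finset.sum_eq_single k] <;> simp +contextual [one_apply, eq_comm]
  constructor
  · rintro ⟨e, he, h⟩
    refine he.congr fun k => ?_
    filter_upwards [h k] with ω hω
    rw [hL]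
    nth_rw 1 [hω]
    simp
  · intro h
    refine ⟨_, h, fun k => Filter.Eventually.of_forall fun ω => ?_⟩
    rw [hL]
    simp

theorem precision_eq_of_factorization (hx : IsZMNG P x)
    {L : Matrix (Fin (N + 1)) (Fin (N + 1)) (Matrix (Fin d) (Fin d) ℝ)}
    {V : Fin (N + 1) → Matrix (Fin d) (Fin d) ℝ}
    (h : L * blockCov P x * Lᴴ = diagonal V) (hV : ∀ k, (V k).det ≠ 0) (i j : Fin (N + 1)) :
    precision P x i j = ∑ k, (L k i)ᵀ * (V k)⁻¹ * L k j := by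
  have hVV : diagonal V * diagonal (fun k => (V k)⁻¹) = 1 := by
    rw [diagonal_mul_diagonal, ← diagonal_one]
    congr 1
    ext1 k
    exact mul_nonsing_inv _ (hV k).isUnit
  have h1 : L * (blockCov P x * Lᴴ * diagonal fun k => (V k)⁻¹) = 1 := by
    rw [← mul_assoc, ← mul_assoc, h, hVV]
  have h2 := mul_eq_one_comm.1 h1
  have h3 : precision P x = Lᴴ * (diagonal fun k => (V k)⁻¹) * L := by
    calc precision P x = precision P x *
          (blockCov P x * Lᴴ * (diagonal fun k => (V k)⁻¹) * L) := by rw [h2, mul_one]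
      _ = (precision P x * blockCov P x) * (Lᴴ * (diagonal fun k => (V k)⁻¹) * L) := by
          simp only [mul_assoc]
      _ = _ := by rw [precision_mul_blockCov hx, one_mul]
  rw [h3, mul_apply]
  refine Finset.sum_congr rfl fun k _ => ?_
  rw [mul_diagonal, conjTranspose_apply, star_eq_conjTranspose,
    conjTranspose_eq_transpose_of_trivial]

end CMSequence

/-! ### Blocks of the model precision matrix, and the conditions (R) and (M). -/

namespace CMSequence

variable {Ω : Type*} {N d : ℕ}

section Entries

variable {c : Fin (N + 1)} {b : BoundaryForm} (M : BackwardParams N d)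

/-- The matrix `L` with `e = L x` for the backward model. -/
def modelMatrix (c : Fin (N + 1)) (b : BoundaryForm) (M : BackwardParams N d) :
    Matrix (Fin (N + 1)) (Fin (N + 1)) (Matrix (Fin d) (Fin d) ℝ) := 1 - modelCoef c b M

theorem modelMatrix_ne_zero (hN : 1 ≤ N) {k j : Fin (N + 1)} (h : modelMatrix c b M k j ≠ 0) :
    j = k ∨ ((j : ℕ) = k + 1 ∧ k ≠ c) ∨ (j = c ∧ k ≠ c) ∨
      (c = 0 ∧ k = 0 ∧ j = Fin.last N ∧ b = .first) := by
  contrapose! h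
  obtain ⟨h1, h2, h3, h4⟩ := h
  rw [modelMatrix, Matrix.sub_apply, one_apply_ne' h1, zero_sub, neg_eq_zero]
  simp only [modelCoef, of_apply]
  by_cases h0 : k ≠ c ∧ k ≠ Fin.last N
  · rw [if_pos h0, if_neg fun h5 => h0.1 (h2 h5), if_neg fun h6 => h0.1 (h3 h6), add_zero]
  · rw [if_neg h0]
    cases b
    · simp only [ite_eq_right_iff]
      rintro ⟨rfl, rfl, rfl⟩
      exact absurd rfl (h4 rfl rfl rfl)
    · simp only [ite_eq_right_iff]
      rintro ⟨rfl, rfl, rfl⟩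
      exact absurd (h3 rfl).symm (zero_ne_last hN)

theorem modelMatrix_self (hN : 1 ≤ N) (k : Fin (N + 1)) : modelMatrix c b M k k = 1 := by
  rw [modelMatrix, Matrix.sub_apply, one_apply_eq, sub_eq_self]
  simp only [modelCoef, of_apply]
  by_cases h0 : k ≠ c ∧ k ≠ Fin.last N
  · rw [if_pos h0, if_neg (by omega), if_neg h0.1, add_zero]
  · rw [if_neg h0]
    cases b
    · simp only [ite_eq_right_iff]
      rintro ⟨rfl, rfl, h⟩
      exact absurd h (zero_ne_last hN)
    · simp only [ite_eq_right_iff]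
      rintro ⟨rfl, rfl, h⟩
      exact absurd h.symm (zero_ne_last hN)

theorem modelMatrix_succ {k j : Fin (N + 1)} (hkc : k ≠ c) (hkj : (j : ℕ) = k + 1) (hj : j ≠ c) :
    modelMatrix c b M k j = -M.G k j := by
  have h1 : k ≠ Fin.last N := by rw [Ne, Fin.ext_iff, Fin.val_last]; omega
  have h2 : k ≠ j := by rw [Ne, Fin.ext_iff]; omega
  rw [modelMatrix, Matrix.sub_apply, one_apply_ne h2]
  simp [modelCoef, hkc, h1, hkj, hj]

theorem modelMatrix_center {k : Fin (N + 1)} (hkc : k ≠ c) (hk : k ≠ Fin.last N)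
    (hc : (c : ℕ) ≠ k + 1) : modelMatrix c b M k c = -M.G k c := by
  rw [modelMatrix, Matrix.sub_apply, one_apply_ne hkc]
  simp [modelCoef, hkc, hk, hc]

theorem modelMatrix_first_zero_last (hN : 1 ≤ N) :
    modelMatrix 0 .first M 0 (Fin.last N) = -M.G 0 (Fin.last N) := by
  rw [modelMatrix, Matrix.sub_apply, one_apply_ne (zero_ne_last hN)]
  simp [modelCoef]

theorem modelMatrix_first_last_zero (hN : 1 ≤ N) :
    modelMatrix 0 .first M (Fin.last N) 0 = 0 := by
  rw [modelMatrix, Matrix.sub_apply, one_apply_ne (zero_ne_last hN).symm]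
  simp [modelCoef, (zero_ne_last hN), (zero_ne_last hN).symm]

theorem modelMatrix_second_last_zero (hN : 1 ≤ N) :
    modelMatrix 0 .second M (Fin.last N) 0 = -M.G (Fin.last N) 0 := by
  rw [modelMatrix, Matrix.sub_apply, one_apply_ne (zero_ne_last hN).symm]
  simp [modelCoef]

/-- The block `(i, j)` of `Lᴴ V⁻¹ L` for the backward model. -/
noncomputable def modelPrecision (c : Fin (N + 1)) (b : BoundaryForm) (M : BackwardParams N d)
    (i j : Fin (N + 1)) : Matrix (Fin d) (Fin d) ℝ :=
  ∑ k, (modelMatrix c b M k i)ᵀ * (M.V k)⁻¹ * modelMatrix c b M k j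

theorem modelPrecision_eq_zero (hN : 1 ≤ N) {i j : Fin (N + 1)}
    (hij : (i : ℕ) + 2 ≤ j) (hi : i ≠ c) (hj : j ≠ c) : modelPrecision c b M i j = 0 := by
  refine Finset.sum_eq_zero fun k _ => ?_
  by_cases h1 : modelMatrix c b M k i = 0
  · simp [h1]
  by_cases h2 : modelMatrix c b M k j = 0
  · simp [h2]
  exfalso
  have h1 := modelMatrix_ne_zero M hN h1
  have h2 := modelMatrix_ne_zero M hN h2
  simp only [Fin.ext_iff, Fin.val_zero, Fin.val_last, Ne] at *
  omega

/-- Only rows `k` and `k + 1` of `L` meet column `k + 1`. The range of `k` keeps both rows away from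
`c` and, for `c = N`, from row `N - 1`, where the coefficient of `x_N` occurs twice. -/
theorem modelPrecision_succ_center (hN : 1 ≤ N) (k : Fin N)
    (hk : (c = 0 ∧ 0 < (k : ℕ) ∧ (k : ℕ) + 1 < N) ∨ (c = Fin.last N ∧ (k : ℕ) + 2 < N)) :
    modelPrecision c b M k.succ c =
      (M.G k.castSucc k.succ)ᵀ * (M.V k.castSucc)⁻¹ * M.G k.castSucc c -
        (M.V k.succ)⁻¹ * M.G k.succ c := by
  have hv : (k.succ : ℕ) = (k.castSucc : ℕ) + 1 := by simp
  have hcs : (k.castSucc : ℕ) = k := rfl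
  rw [modelPrecision, Finset.sum_eq_add k.castSucc k.succ]
  · rw [modelMatrix_self M hN, modelMatrix_succ M (k := k.castSucc) (j := k.succ),
      modelMatrix_center M (k := k.castSucc), modelMatrix_center M (k := k.succ)]
    · simp [sub_eq_add_neg]
    all_goals
      simp only [Fin.ext_iff, Fin.val_zero, Fin.val_last, Ne] at *
      omega
  · simp only [Fin.ext_iff, Ne]
    omega
  · intro i _ hi
    suffices h : modelMatrix c b M i k.succ = 0 by simp [h]
    by_contra h
    have h := modelMatrix_ne_zero M hN h
    simp only [Fin.ext_iff, Fin.val_zero, Fin.val_last, Ne] at *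
    omega
  · simp
  · simp

/-- For `c = N`, column `0` of `L` is nonzero only in row `0`, which differs from row `N - 1`
because `N ≥ 2`. -/
theorem modelPrecision_zero_last (hN : 2 ≤ N) :
    modelPrecision (Fin.last N) b M 0 (Fin.last N) = -((M.V 0)⁻¹ * M.G 0 (Fin.last N)) := by
  have hN' : 1 ≤ N := by omega
  rw [modelPrecision, Finset.sum_eq_single 0]
  · rw [modelMatrix_self M hN', modelMatrix_center M (k := 0)]
    · simp
    all_goals
      simp only [Fin.ext_iff, Fin.val_zero, Fin.val_last, Ne] at *
      omega
  · intro i _ hi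
    suffices h : modelMatrix (Fin.last N) b M i 0 = 0 by simp [h]
    by_contra h
    have h := modelMatrix_ne_zero M hN' h
    simp only [Fin.ext_iff, Fin.val_zero, Fin.val_last, Ne] at *
    omega
  · simp

theorem modelPrecision_first_zero_last (hN : 2 ≤ N) :
    modelPrecision 0 .first M 0 (Fin.last N) =
      (M.G (penult N) 0)ᵀ * (M.V (penult N))⁻¹ * M.G (penult N) (Fin.last N) -
        (M.V 0)⁻¹ * M.G 0 (Fin.last N) := by
  have hN' : 1 ≤ N := by omega
  have hp : (penult N : ℕ) = N - 1 := rfl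
  rw [modelPrecision, Finset.sum_eq_add (penult N) 0]
  · rw [modelMatrix_self M hN', modelMatrix_center M (k := penult N),
      modelMatrix_succ M (k := penult N), modelMatrix_first_zero_last M hN']
    · simp [sub_eq_add_neg]
    all_goals
      simp only [Fin.ext_iff, Fin.val_zero, Fin.val_last, Ne] at *
      omega
  · simp only [Fin.ext_iff, Fin.val_zero, Ne]
    omega
  · intro i _ hi
    by_cases hl : i = Fin.last N
    · subst hl
      simp [modelMatrix_first_last_zero M hN']
    suffices h : modelMatrix 0 .first M i (Fin.last N) = 0 by simp [h]
    by_contra h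
    have h := modelMatrix_ne_zero M hN' h
    simp only [Fin.ext_iff, Fin.val_zero, Fin.val_last, Ne] at *
    omega
  · simp
  · simp

theorem modelPrecision_second_last_zero (hN : 2 ≤ N) :
    modelPrecision 0 .second M (Fin.last N) 0 =
      (M.G (penult N) (Fin.last N))ᵀ * (M.V (penult N))⁻¹ * M.G (penult N) 0 -
        (M.V (Fin.last N))⁻¹ * M.G (Fin.last N) 0 := by
  have hN' : 1 ≤ N := by omega
  have hp : (penult N : ℕ) = N - 1 := rfl
  rw [modelPrecision, Finset.sum_eq_add (penult N) (Fin.last N)]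
  · rw [modelMatrix_self M hN', modelMatrix_center M (k := penult N),
      modelMatrix_succ M (k := penult N), modelMatrix_second_last_zero M hN']
    · simp [sub_eq_add_neg]
    all_goals
      simp only [Fin.ext_iff, Fin.val_zero, Fin.val_last, Ne] at *
      omega
  · simp only [Fin.ext_iff, Fin.val_last, Ne]
    omega
  · intro i _ hi
    suffices h : modelMatrix 0 .second M i (Fin.last N) = 0 by simp [h]
    by_contra h
    have h := modelMatrix_ne_zero M hN' h
    simp only [reduceCtorEq, and_false, or_false] at h
    simp only [Fin.ext_iff, Fin.val_zero, Fin.val_last, Ne] at h hi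
    omega
  · simp
  · simp

end Entries

variable [MeasurableSpace Ω] {P : Measure Ω} [IsProbabilityMeasure P]
  {x : Fin (N + 1) → Ω → (Fin d → ℝ)} {c : Fin (N + 1)} {b : BoundaryForm}
  {M : BackwardParams N d}

theorem precision_eq_modelPrecision (hx : IsZMNG P x) (hN : 1 ≤ N)
    (hc : c = 0 ∨ c = Fin.last N) (hM : GovernedBy P x c b M) (i j : Fin (N + 1)) :
    precision P x i j = modelPrecision c b M i j := by
  obtain ⟨h, hV⟩ := (governedBy_iff_covariance hx hN hc b M).1 hM
  exact precision_eq_of_factorization hx h hV i j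

/-- Among the blocks that reciprocity requires to vanish, those off row and column `c` vanish for
every model; the others are, up to transposition, the blocks `(k + 1, c)` with `k` in the range of
(R). -/
theorem isReciprocal_iff_of_governedBy (hx : IsZMNG P x) (hmeas : ∀ k, Measurable (x k))
    (hN : 1 ≤ N) (hc : c = 0 ∨ c = Fin.last N) (hM : GovernedBy P x c b M) :
    IsReciprocal P x ↔ ReciprocalCondition c M := by
  rw [isReciprocal_iff_precision hx hmeas]
  have hprec := precision_eq_modelPrecision hx hN hc hM
  have key : ∀ k : Fin N,
      ((c = 0 ∧ 0 < (k : ℕ) ∧ (k : ℕ) + 1 < N) ∨ (c = Fin.last N ∧ (k : ℕ) + 2 < N)) →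
      ((M.V k.succ)⁻¹ * M.G k.succ c =
        (M.G k.castSucc k.succ)ᵀ * (M.V k.castSucc)⁻¹ * M.G k.castSucc c ↔
        precision P x k.succ c = 0) := by
    intro k hk
    rw [hprec, modelPrecision_succ_center M hN k hk, sub_eq_zero, eq_comm]
  constructor
  · intro h k hk
    rw [key k hk]
    rcases hk with ⟨rfl, h1, h2⟩ | ⟨rfl, h1⟩
    · rw [precision_conjTranspose hx 0 k.succ, h 0 k.succ, transpose_zero] <;>
        simp only [Fin.val_zero, Fin.val_succ] <;> omega
    · refine h _ _ ?_ ?_ <;> simp only [Fin.val_last, Fin.val_succ] <;> omega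
  · intro h i j hij h0N
    by_cases hi : i = c
    · have hc0 : c = 0 := hc.resolve_right fun hcl => by
        subst hi
        rw [hcl, Fin.val_last] at hij
        omega
      subst hi
      subst hc0
      rw [Fin.val_zero] at hij h0N
      obtain ⟨k, hk⟩ : ∃ k : Fin N, k.succ = j := ⟨⟨j - 1, by omega⟩, Fin.ext (by simp; omega)⟩
      have hkj : (k : ℕ) + 1 = j := by rw [← hk, Fin.val_succ]
      have hr : ((0 : Fin (N + 1)) = 0 ∧ 0 < (k : ℕ) ∧ (k : ℕ) + 1 < N) ∨
          ((0 : Fin (N + 1)) = Fin.last N ∧ (k : ℕ) + 2 < N) := Or.inl ⟨rfl, by omega, by omega⟩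
      rw [precision_conjTranspose hx j 0, ← hk, (key k hr).1 (h k hr), transpose_zero]
    · by_cases hj : j = c
      · have hcl : c = Fin.last N := hc.resolve_left fun hc0 => by
          subst hj
          rw [hc0, Fin.val_zero] at hij
          omega
        subst hj
        subst hcl
        rw [Fin.val_last] at hij h0N
        obtain ⟨k, hk⟩ : ∃ k : Fin N, k.succ = i :=
          ⟨⟨i - 1, by omega⟩, Fin.ext (by simp; omega)⟩
        have hki : (k : ℕ) + 1 = i := by rw [← hk, Fin.val_succ]
        have hr : (Fin.last N = 0 ∧ 0 < (k : ℕ) ∧ (k : ℕ) + 1 < N) ∨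
            (Fin.last N = Fin.last N ∧ (k : ℕ) + 2 < N) := Or.inr ⟨rfl, by omega⟩
        rw [← hk, (key k hr).1 (h k hr)]
      · rw [hprec, modelPrecision_eq_zero M hN hij hi hj]

theorem isMarkov_iff_isReciprocal_and (hx : IsZMNG P x) (hmeas : ∀ k, Measurable (x k))
    (hN : 2 ≤ N) :
    IsMarkov P x ↔ IsReciprocal P x ∧ precision P x 0 (Fin.last N) = 0 := by
  rw [isMarkov_iff_precision hx hmeas, isReciprocal_iff_precision hx hmeas]
  constructor
  · exact fun h => ⟨fun i j hij _ => h i j hij, h _ _ (by simpa using hN)⟩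
  · rintro ⟨h, h0⟩ i j hij
    by_cases hij' : (i : ℕ) = 0 ∧ (j : ℕ) = N
    · rwa [show i = 0 from Fin.ext hij'.1, show j = Fin.last N from Fin.ext hij'.2]
    · exact h i j hij hij'

theorem precision_zero_last_iff_of_governedBy (hx : IsZMNG P x) (hN : 2 ≤ N)
    (hc : c = 0 ∨ c = Fin.last N) (hM : GovernedBy P x c b M) :
    precision P x 0 (Fin.last N) = 0 ↔ MarkovCondition c b M := by
  have hN' : 1 ≤ N := by omega
  have h0N := zero_ne_last hN'
  have hprec := precision_eq_modelPrecision hx hN' hc hM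
  have hV := ((governedBy_iff_covariance hx hN' hc b M).1 hM).2
  rcases hc with rfl | rfl
  · cases b
    · rw [hprec, modelPrecision_first_zero_last M hN, sub_eq_zero, eq_comm]
      simp [MarkovCondition, h0N]
    -- With the second boundary form the equation linking the endpoints sits in row `N`, so the
    -- transposed corner has the shape of (M).
    · rw [precision_conjTranspose hx (Fin.last N) 0, transpose_eq_zero, hprec,
        modelPrecision_second_last_zero M hN, sub_eq_zero, eq_comm]
      simp [MarkovCondition, h0N]
  · rw [hprec, modelPrecision_zero_last M hN, neg_eq_zero]
    have : (M.V 0)⁻¹ * M.G 0 (Fin.last N) = 0 ↔ M.G 0 (Fin.last N) = 0 := by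
      constructor
      · intro h
        rw [← mul_nonsing_inv_cancel_left _ (M.G 0 (Fin.last N)) (hV 0).isUnit, h, mul_zero]
      · intro h
        rw [h, mul_zero]
    rw [this]
    simp [MarkovCondition, h0N.symm]

end CMSequence

/-! ### Existence of a model for a reciprocal sequence, by elimination without fill-in. -/

namespace CMSequence

variable {Ω : Type*} {N d : ℕ}

/-- Elimination order: the state at time `c` comes last, or, if `c = 0` and the boundary
condition is of the first form, last but one. -/
def elimRank (c : Fin (N + 1)) (b : BoundaryForm) (k : Fin (N + 1)) : ℕ :=
  if k = c then
    match b with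
    -- For `c = 0` this lies between the ranks `2 * (N - 1)` and `2 * N` of the times `N - 1` and
    -- `N`; for `c = N` it is still the largest rank.
    | .first => 2 * N - 1
    | .second => 2 * N + 1
  else 2 * k

theorem elimRank_cases (c : Fin (N + 1)) (b : BoundaryForm) (k : Fin (N + 1)) :
    ((k : ℕ) = c ∧ (b = .first ∧ elimRank c b k = 2 * N - 1 ∨
      b = .second ∧ elimRank c b k = 2 * N + 1)) ∨
      ((k : ℕ) ≠ c ∧ elimRank c b k = 2 * k) := by
  by_cases h : k = c
  · left
    subst h
    cases b <;> simp [elimRank]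
  · right
    exact ⟨fun h' => h (Fin.ext h'), by simp [elimRank, h]⟩

theorem elimRank_injective (hN : 1 ≤ N) (c : Fin (N + 1)) (b : BoundaryForm) :
    Function.Injective (elimRank c b) := by
  intro k l h
  have hk := elimRank_cases c b k
  have hl := elimRank_cases c b l
  apply Fin.ext
  cases b <;> simp only [reduceCtorEq, false_and, or_false, false_or, true_and] at hk hl <;> omega

variable [MeasurableSpace Ω] {P : Measure Ω} [IsProbabilityMeasure P]
  {x : Fin (N + 1) → Ω → (Fin d → ℝ)}

theorem blockCov_conjTranspose (hx : IsZMNG P x) : (blockCov P x)ᴴ = blockCov P x := by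
  ext k l a b
  have := (posDef_seqCov hx).1.apply (k, a) (l, b)
  exact this

/-- Block factorization of the covariance, unitriangular with respect to an ordering `r`
of the times. -/
theorem exists_triangular_factorization (hx : IsZMNG P x) {r : Fin (N + 1) → ℕ}
    (hr : Function.Injective r) :
    ∃ (L : Matrix (Fin (N + 1)) (Fin (N + 1)) (Matrix (Fin d) (Fin d) ℝ))
      (V : Fin (N + 1) → Matrix (Fin d) (Fin d) ℝ),
      (∀ k, L k k = 1) ∧ (∀ k j, r j < r k → L k j = 0) ∧
        L * blockCov P x * Lᴴ = diagonal V ∧ ∀ k, (V k).det ≠ 0 := by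
  have hC := posDef_seqCov hx
  -- Each coordinate is regressed on the coordinates of all times of higher rank. The rows of `L`
  -- are the residuals, uncorrelated with those times.
  choose w hw0 hw using fun p : Fin (N + 1) × Fin d =>
    exists_vecMul_eq_on hC {q | r p.1 < r q.1} (seqCov P x p)
  set L' : Matrix (Fin (N + 1) × Fin d) (Fin (N + 1) × Fin d) ℝ := 1 - Matrix.of w with hL'
  set L := (Matrix.compRingEquiv (Fin (N + 1)) (Fin d) ℝ).symm L' with hL
  have hLapp : ∀ k j a b, L k j a b = L' (k, a) (j, b) := fun _ _ _ _ => rfl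
  have hdiag : ∀ k, L k k = 1 := by
    intro k
    ext a b
    rw [hLapp, hL', Matrix.sub_apply, of_apply, hw0 (k, a) (k, b) (by simp), sub_zero]
    simp [one_apply]
  have htri : ∀ k j, r j < r k → L k j = 0 := by
    intro k j hjk
    ext a b
    rw [hLapp, hL', Matrix.sub_apply, of_apply, hw0 (k, a) (j, b) (by simpa using hjk.le), sub_zero,
      one_apply_ne fun h => by simp only [Prod.mk.injEq] at h; rw [h.1] at hjk; exact lt_irrefl _ hjk]
    rfl
  have hLC : ∀ k j, r k < r j → (L * blockCov P x) k j = 0 := by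
    intro k j hkj
    ext a b
    have h1 : (L * blockCov P x) k j a b = (L' * seqCov P x) (k, a) (j, b) := by
      change (Matrix.compRingEquiv (Fin (N + 1)) (Fin d) ℝ (L * blockCov P x)) (k, a) (j, b) = _
      rw [map_mul, hL, RingEquiv.apply_symm_apply]
      rfl
    rw [h1, hL', Matrix.sub_mul, Matrix.one_mul, Matrix.sub_apply]
    have := hw (k, a) (j, b) hkj
    rw [Matrix.zero_apply, sub_eq_zero, ← this]
    rfl
  have hE : (L * blockCov P x * Lᴴ)ᴴ = L * blockCov P x * Lᴴ := by
    rw [conjTranspose_mul, conjTranspose_mul, conjTranspose_conjTranspose,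
      blockCov_conjTranspose hx, mul_assoc]
  have hup : ∀ k l, r k < r l → (L * blockCov P x * Lᴴ) k l = 0 := by
    intro k l hkl
    rw [mul_apply]
    refine Finset.sum_eq_zero fun j _ => ?_
    by_cases hj : r k < r j
    · rw [hLC k j hj, zero_mul]
    · rw [conjTranspose_apply, htri l j (by omega), star_zero, mul_zero]
  refine ⟨L, fun k => (L * blockCov P x * Lᴴ) k k, hdiag, htri, ?_, fun k => ?_⟩
  · ext1 k l
    by_cases hkl : k = l
    · subst hkl
      rw [diagonal_apply_eq]
    · rw [diagonal_apply_ne _ hkl]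
      rcases lt_or_gt_of_ne fun h => hkl (hr h) with h | h
      · exact hup k l h
      · rw [← hE, conjTranspose_apply, hup l k h, star_zero]
  -- Block row `k` of `L` contains an identity block, so it is injective and the residual covariance
  -- is positive definite.
  · set B : Matrix (Fin d) (Fin (N + 1) × Fin d) ℝ := Matrix.of fun a p => L k p.1 a p.2 with hB
    have h1 : (L * blockCov P x * Lᴴ) k k = B * seqCov P x * Bᴴ := by
      ext a b
      change (Matrix.compRingEquiv (Fin (N + 1)) (Fin d) ℝ
        (L * blockCov P x * Lᴴ)) (k, a) (k, b) = _
      rw [map_mul, map_mul]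
      rfl
    have hinj : Function.Injective B.vecMul := by
      intro u v huv
      have h2 : ∀ u : Fin d → ℝ, ∀ b, (u ᵥ* B) (k, b) = u b := by
        intro u b
        have : ∀ a, B a (k, b) = (1 : Matrix (Fin d) (Fin d) ℝ) a b := fun a => by
          rw [hB, of_apply, hdiag]
        simp [vecMul, dotProduct, this, one_apply]
      ext b
      rw [← h2 u, ← h2 v]
      exact congrFun huv (k, b)
    simp only [h1]
    exact (hC.mul_mul_conjTranspose_same hinj).det_pos.ne'

/-- If the precision matrix is cyclically tridiagonal, its triangular factor has the sparsity
pattern of the backward model. -/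
theorem factor_ne_zero (hN : 1 ≤ N) {c : Fin (N + 1)} (hc : c = 0 ∨ c = Fin.last N)
    (b : BoundaryForm) {A L : Matrix (Fin (N + 1)) (Fin (N + 1)) (Matrix (Fin d) (Fin d) ℝ)}
    {V : Fin (N + 1) → Matrix (Fin d) (Fin d) ℝ}
    (hA0 : ∀ i j : Fin (N + 1), (i : ℕ) + 2 ≤ j → ¬ ((i : ℕ) = 0 ∧ (j : ℕ) = N) → A i j = 0)
    (hA : ∀ i j, A i j = ∑ k, (L k i)ᵀ * (V k)⁻¹ * L k j) (hL1 : ∀ k, L k k = 1)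
    (hL0 : ∀ k j, elimRank c b j < elimRank c b k → L k j = 0) (hV : ∀ k, (V k).det ≠ 0) :
    ∀ k j, L k j ≠ 0 → j = k ∨ ((j : ℕ) = k + 1 ∧ k ≠ c) ∨ (j = c ∧ k ≠ c) ∨
      (c = 0 ∧ k = 0 ∧ j = Fin.last N ∧ b = .first) := by
  suffices h : ∀ n k, elimRank c b k = n → ∀ j, L k j ≠ 0 →
      j = k ∨ ((j : ℕ) = k + 1 ∧ k ≠ c) ∨ (j = c ∧ k ≠ c) ∨
      (c = 0 ∧ k = 0 ∧ j = Fin.last N ∧ b = .first) from fun k => h _ k rfl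
  intro n
  induction n using Nat.strong_induction_on with
  | _ n ih =>
  rintro k rfl j
  contrapose!
  rintro ⟨h1, h2, h3, h4⟩
  rcases lt_or_gt_of_ne fun h => h1 (elimRank_injective hN c b h) with hlt | hlt
  · exact hL0 k j hlt
  have hk := elimRank_cases c b k
  have hj := elimRank_cases c b j
  have hjN := j.2
  -- For `j` of higher rank than `k`, a position outside the pattern is at distance at least two and
  -- is not the corner.
  have hAkj : A k j = 0 := by
    refine hA0 k j ?_ ?_ <;> cases b <;>
      simp only [reduceCtorEq, false_and, or_false, false_or, true_and, ne_eq, not_true_eq_false,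
        imp_false, not_false_eq_true, imp_true_iff,
        Fin.ext_iff, Fin.val_zero, Fin.val_last] at * <;> omega
  -- Rows of higher rank than `k` vanish in column `k`. A row of lower rank that is nonzero in both
  -- columns `k` and `j` would, by the induction hypothesis, place `(k, j)` in the pattern: this is
  -- the absence of fill-in.
  have hsum : A k j = (V k)⁻¹ * L k j := by
    rw [hA, Finset.sum_eq_single k]
    · simp [hL1]
    · intro i _ hik
      by_cases g1 : L i k = 0
      · simp [g1]
      by_cases g2 : L i j = 0
      · simp [g2]
      exfalso
      rcases lt_or_gt_of_ne fun h => hik (elimRank_injective hN c b h) with hi | hi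
      · have p1 := ih _ hi i rfl k g1
        have p2 := ih _ hi i rfl j g2
        have hi' := elimRank_cases c b i
        clear ih hA hA0 hL0 hL1 hV hAkj g1 g2
        cases b <;>
          simp only [reduceCtorEq, false_and, or_false, false_or, true_and, and_true, and_false,
            ne_eq, not_true_eq_false, imp_false, not_false_eq_true, imp_true_iff,
            Fin.ext_iff, Fin.val_zero, Fin.val_last] at * <;> omega
      · exact g1 (hL0 i k hi)
    · simp
  rw [← mul_nonsing_inv_cancel_left _ (L k j) (hV k).isUnit, ← hsum, hAkj, mul_zero]

theorem exists_modelMatrix_eq (hN : 1 ≤ N) {c : Fin (N + 1)} (hc : c = 0 ∨ c = Fin.last N)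
    (b : BoundaryForm) {L : Matrix (Fin (N + 1)) (Fin (N + 1)) (Matrix (Fin d) (Fin d) ℝ)}
    (V : Fin (N + 1) → Matrix (Fin d) (Fin d) ℝ) (hL1 : ∀ k, L k k = 1)
    (hL0 : ∀ k j, elimRank c b j < elimRank c b k → L k j = 0)
    (hL : ∀ k j, L k j ≠ 0 → j = k ∨ ((j : ℕ) = k + 1 ∧ k ≠ c) ∨ (j = c ∧ k ≠ c) ∨
      (c = 0 ∧ k = 0 ∧ j = Fin.last N ∧ b = .first)) :
    ∃ M : BackwardParams N d, M.V = V ∧ 1 - modelCoef c b M = L := by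
  -- When `j = k + 1 = c`, that is `c = N` and `k = N - 1`, the same matrix multiplies both
  -- `x_{k+1}` and `x_c`, so it has to carry half of the total coefficient.
  refine ⟨⟨fun k j => if (j : ℕ) = k + 1 ∧ j = c then -((1 / 2 : ℝ) • L k j) else -L k j, V⟩,
    rfl, ?_⟩
  set M : BackwardParams N d :=
    ⟨fun k j => if (j : ℕ) = k + 1 ∧ j = c then -((1 / 2 : ℝ) • L k j) else -L k j, V⟩ with hM
  ext1 k j
  by_cases hjk : j = k
  · subst hjk
    rw [hL1]
    exact modelMatrix_self M hN j
  by_cases hpat : modelMatrix c b M k j = 0 ∧ L k j = 0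
  · exact hpat.1.trans hpat.2.symm
  have hpat : ((j : ℕ) = k + 1 ∧ k ≠ c) ∨ (j = c ∧ k ≠ c) ∨
      (c = 0 ∧ k = 0 ∧ j = Fin.last N ∧ b = .first) := by
    by_cases h : modelMatrix c b M k j = 0
    · exact (hL k j fun h' => hpat ⟨h, h'⟩).resolve_left hjk
    · exact (modelMatrix_ne_zero M hN h).resolve_left hjk
  by_cases hk : k ≠ c ∧ k ≠ Fin.last N
  · rw [Matrix.sub_apply, one_apply_ne (Ne.symm hjk)]
    simp only [modelCoef, of_apply, if_pos hk, hM]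
    by_cases h1 : (j : ℕ) = k + 1 <;> by_cases h2 : j = c
    · rw [if_pos h1, if_pos h2, if_pos ⟨h1, h2⟩, zero_sub, neg_add, neg_neg, ← add_smul]
      norm_num
    · simp [h1, h2]
    · rw [if_neg h1, if_pos h2, if_neg fun h => h1 h.1]
      simp
    · exfalso
      rcases hpat with h | h | h
      · exact h1 h.1
      · exact h2 h.1
      · exact hk.1 (h.2.1.trans h.1.symm)
  · have hkj : ¬ ((j : ℕ) = k + 1 ∧ j = c) := by
      rintro ⟨h1, rfl⟩
      have : k ≠ Fin.last N := fun h => by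
        have := j.2
        rw [h, Fin.val_last] at h1
        omega
      exact hk ⟨fun h => hjk h.symm, this⟩
    have hGkj : M.G k j = -L k j := by simp only [hM, if_neg hkj]
    rw [Matrix.sub_apply, one_apply_ne (Ne.symm hjk), zero_sub]
    simp only [modelCoef, of_apply, if_neg hk]
    have hj2 := j.2
    cases b
    · by_cases h : c = 0 ∧ k = c ∧ j = Fin.last N
      · simp only [if_pos h, hGkj, neg_neg]
      · simp only [if_neg h, neg_zero]
        -- What remains is row `N` with `j = c = 0`, in the pattern but absent from the first
        -- boundary form; there `c` has lower rank than `N`, so triangularity makes the block zero.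
        refine (hL0 k j ?_).symm
        have r1 := elimRank_cases c .first k
        have r2 := elimRank_cases c .first j
        simp only [reduceCtorEq, false_and, or_false, true_and, and_true, ne_eq, Fin.ext_iff,
          Fin.val_zero, Fin.val_last] at *
        omega
    · by_cases h : c = 0 ∧ k = Fin.last N ∧ j = c
      · simp only [if_pos h, hGkj, neg_neg]
      · exfalso
        simp only [reduceCtorEq, or_false, and_false, ne_eq, Fin.ext_iff, Fin.val_zero,
          Fin.val_last] at *
        omega

theorem exists_governedBy_of_isReciprocal (hx : IsZMNG P x) (hmeas : ∀ k, Measurable (x k))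
    (hN : 1 ≤ N) {c : Fin (N + 1)} (hc : c = 0 ∨ c = Fin.last N) (b : BoundaryForm)
    (h : IsReciprocal P x) : ∃ M : BackwardParams N d, GovernedBy P x c b M := by
  obtain ⟨L, V, hL1, hL0, hfac, hV⟩ :=
    exists_triangular_factorization hx (elimRank_injective hN c b)
  have hL := factor_ne_zero hN hc b ((isReciprocal_iff_precision hx hmeas).1 h)
    (precision_eq_of_factorization hx hfac hV) hL1 hL0 hV
  obtain ⟨M, rfl, hM⟩ := exists_modelMatrix_eq hN hc b V hL1 hL0 hL
  refine ⟨M, (governedBy_iff_covariance hx hN hc b M).2 ⟨?_, hV⟩⟩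
  rw [hM, hfac]

end CMSequence

/-! ### The characterization theorem. -/

theorem mainTheorem5 {Ω : Type*} [MeasurableSpace Ω] (P : Measure Ω) [IsProbabilityMeasure P]
    {N d : ℕ} (hN : 1 ≤ N) (x : Fin (N + 1) → Ω → (Fin d → ℝ))
    (hmeas : ∀ k, Measurable (x k)) (hx : CMSequence.IsZMNG P x)
    (c : Fin (N + 1)) (hc : c = 0 ∨ c = Fin.last N) (b : CMSequence.BoundaryForm) :
    (CMSequence.IsReciprocal P x ↔
      ∃ M : CMSequence.BackwardParams N d,
        CMSequence.GovernedBy P x c b M ∧ CMSequence.ReciprocalCondition c M) ∧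
    (2 ≤ N →
      (CMSequence.IsMarkov P x ↔
        ∃ M : CMSequence.BackwardParams N d,
          CMSequence.GovernedBy P x c b M ∧ CMSequence.ReciprocalCondition c M ∧
            CMSequence.MarkovCondition c b M)) ∧
    (∀ M : CMSequence.BackwardParams N d, CMSequence.GovernedBy P x c b M →
      (CMSequence.IsReciprocal P x ↔ CMSequence.ReciprocalCondition c M) ∧
      (2 ≤ N →
        (CMSequence.IsMarkov P x ↔
          CMSequence.ReciprocalCondition c M ∧ CMSequence.MarkovCondition c b M))) := by
  have hrec : ∀ M : CMSequence.BackwardParams N d, CMSequence.GovernedBy P x c b M →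
      (CMSequence.IsReciprocal P x ↔ CMSequence.ReciprocalCondition c M) :=
    fun M hM => CMSequence.isReciprocal_iff_of_governedBy hx hmeas hN hc hM
  have hmar : ∀ M : CMSequence.BackwardParams N d, CMSequence.GovernedBy P x c b M → 2 ≤ N →
      (CMSequence.IsMarkov P x ↔
        CMSequence.ReciprocalCondition c M ∧ CMSequence.MarkovCondition c b M) :=
    fun M hM hN2 => by
      rw [CMSequence.isMarkov_iff_isReciprocal_and hx hmeas hN2, hrec M hM,
        CMSequence.precision_zero_last_iff_of_governedBy hx hN2 hc hM]
  have hex := CMSequence.exists_governedBy_of_isReciprocal hx hmeas hN hc b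
  refine ⟨⟨fun h => ?_, fun ⟨M, hM, hR⟩ => (hrec M hM).2 hR⟩, fun hN2 => ⟨fun h => ?_,
    fun ⟨M, hM, hRM⟩ => (hmar M hM hN2).2 hRM⟩, fun M hM => ⟨hrec M hM, hmar M hM⟩⟩
  · obtain ⟨M, hM⟩ := hex h
    exact ⟨M, hM, (hrec M hM).1 h⟩
  · obtain ⟨M, hM⟩ := hex ((CMSequence.isMarkov_iff_isReciprocal_and hx hmeas hN2).1 h).1
    exact ⟨M, hM, (hmar M hM hN2).1 h⟩
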